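/- **Notation.** Let $\mathcal Z$ be a linear subspace of $\mathrm{Sym}(p,\mathbb R)$ and write $\langle x,y\rangle=\operatorname{tr}(xy)$. Let $\mathcal P_{\mathcal Z}$ be the set of positive definite matrices in $\mathcal Z$, assumed non-empty, and let $\mathcal P^*_{\mathcal Z}=\{y\in\mathcal Z : \langle x,y\rangle>0 \text{ for all } x\in\overline{\mathcal P_{\mathcal Z}}\setminus\{0\}\}$. Let $dx$ be Lebesgue measure on $\mathcal Z$ in the coordinates of an orthonormal basis for $\langle\cdot,\cdot\rangle$. For $y\in\mathcal P^*_{\mathcal Z}$ let $\psi_{\mathcal Z}(y)$ be the point of $\mathcal P_{\mathcal Z}$ where $x\mapsto e^{-\langle x,y\rangle}\det x$ attains its maximum on $\mathcal P_{\mathcal Z}$, and put $\delta_{\mathcal Z}(y)=(\det\psi_{\mathcal Z}(y))^{-1}$. Let $S_{\mathcal Z}(y):\mathcal Z\to\mathcal Z$ be the linear operator with $$\langle S_{\mathcal Z}(y)u,v\rangle=-\frac{\partial^2}{\partial s\,\partial t}\log\delta_{\mathcal Z}(y+su+tv)\Big|_{s=t=0}\qquad(u,v\in\mathcal Z),$$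 and put $\varphi_{\mathcal Z}(y)=(\det S_{\mathcal Z}(y))^{1/2}$. For $\alpha\ge 0$ put $\gamma_{\mathcal Z}(\alpha)=\int_{\mathcal P_{\mathcal Z}}e^{-\operatorname{tr}x}(\det x)^\alpha\,dx$. **Block matrix spaces.** Let $n_1,\dots,n_r$ be positive integers, $p=n_1+\dots+n_r$, and let $V_{lk}\subset\mathrm{Mat}(n_l,n_k;\mathbb R)$ $(1\le k<l\le r)$ be linear subspaces such that * (V1) $A\in V_{lk}\Rightarrow AA^{t}\in\mathbb R I_{n_l}$ for $k<l$; * (V2) $A\in V_{lj},\ B\in V_{kj}\Rightarrow AB^{t}\in V_{lk}$ for $j<k<l$; * (V3) $A\in V_{lk},\ B\in V_{kj}\Rightarrow AB\in V_{lj}$ for $j<k<l$. Let $\mathcal Z_V$ be the space of all $x\in\mathrm{Sym}(p,\mathbb R)$ whose blocks $X_{lk}\in\mathrm{Mat}(n_l,n_k;\mathbb R)$ satisfy $X_{kk}\in\mathbb R I_{n_k}$ for all $k$ and $X_{lk}\in V_{lk}$ for $k<l$. Put $N=\dim\mathcal Z_V$ and $q_k=\sum_{l>k}\dim V_{lk}$.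 **Theorem.** (i) For every $\alpha\ge 0$ the integral defining $\gamma_{\mathcal Z_V}(\alpha)$ converges and $$\gamma_{\mathcal Z_V}(\alpha)=(2\pi)^{(N-r)/2}\prod_{k=1}^r\Bigl(n_k^{-n_k\alpha-(q_k+1)/2}\,\Gamma\bigl(n_k\alpha+\tfrac{q_k}{2}+1\bigr)\Bigr).$$ (ii) For every $y\in\mathcal P^*_{\mathcal Z_V}$ the maximizer $\psi_{\mathcal Z_V}(y)$ exists and is unique, $\log\delta_{\mathcal Z_V}$ is twice continuously differentiable at $y$, and the operator $S_{\mathcal Z_V}(y)$ exists and is unique. For every $\alpha\ge 0$ the integral below converges and $$\int_{\mathcal P_{\mathcal Z_V}}e^{-\langle x,y\rangle}(\det x)^\alpha\,dx=\gamma_{\mathcal Z_V}(\alpha)\,\varphi_{\mathcal Z_V}(y)\,\delta_{\mathcal Z_V}(y)^{-\alpha}.$$ -/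

import Mathlib

open MeasureTheory Matrix
open scoped Matrix.Norms.Frobenius

noncomputable section

namespace MatrixCone

/-! ### The Euclidean structure on matrix spaces

Real matrices carry the inner product `tr (Aᵀ B)`, whose norm is the Frobenius norm.  On symmetric
matrices it is the trace inner product `tr (x y)`.  Every linear subspace inherits this inner
product, and its `volume` is the Lebesgue measure of the coordinates in an orthonormal basis. -/

instance matrixMeasurableSpace (m n : Type*) : MeasurableSpace (Matrix m n ℝ) :=
  borel (Matrix m n ℝ)

instance matrixBorelSpace (m n : Type*) : BorelSpace (Matrix m n ℝ) := ⟨rfl⟩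

/-- The same fact for the topology of the Frobenius norm, which is the same topology. -/
instance matrixBorelSpaceNorm (m n : Type*) [Fintype m] [Fintype n] :
    @BorelSpace (Matrix m n ℝ)
      (frobeniusNormedAddCommGroup (m := m) (n := n) (α := ℝ)).toPseudoMetricSpace.toUniformSpace.toTopologicalSpace
      (matrixMeasurableSpace m n) := ⟨rfl⟩

instance matrixInnerProductSpace (m n : Type*) [Fintype m] [Fintype n] :
    InnerProductSpace ℝ (Matrix m n ℝ) where
  inner A B := (Aᵀ * B).trace
  norm_sq_eq_re_inner A := by
    have h0 : (0 : ℝ) ≤ ∑ i, ∑ j, ‖A i j‖ ^ (2 : ℝ) := by positivity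
    rw [Matrix.frobenius_norm_def, ← Real.sqrt_eq_rpow, Real.sq_sqrt h0, Finset.sum_comm]
    simp [Matrix.trace, Matrix.mul_apply, sq]
  conj_inner_symm A B := by
    rw [← Matrix.trace_transpose]
    simp
  add_left A B C := by simp [Matrix.add_mul]
  smul_left A B c := by simp

section General

/-! ### Functions attached to a linear space `Z` of real symmetric matrices -/

variable {ι : Type*} [Fintype ι] [DecidableEq ι] (Z : Submodule ℝ (Matrix ι ι ℝ))

/-- The pairing `⟨x, y⟩ = tr (x y)`. -/
def pairing (x y : Matrix ι ι ℝ) : ℝ := (x * y).trace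

/-- The cone of positive definite matrices in `Z`. -/
def posCone : Set Z := {x | (x : Matrix ι ι ℝ).PosDef}

/-- The dual cone: those `y ∈ Z` with `⟨x, y⟩ > 0` for all nonzero `x` in the closure of the cone
of positive definite matrices in `Z`. -/
def dualCone : Set Z :=
  {y | ∀ x ∈ closure (posCone Z), x ≠ 0 → 0 < pairing (x : Matrix ι ι ℝ) y}

/-- On the positive definite matrices in `Z`, the function `x ↦ exp (-⟨x, y⟩) det x` attains its
maximum at `x₀`. -/
def IsMaximizer (y x₀ : Z) : Prop :=
  x₀ ∈ posCone Z ∧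
    IsMaxOn (fun x : Z => Real.exp (-pairing (x : Matrix ι ι ℝ) y) * (x : Matrix ι ι ℝ).det)
      (posCone Z) x₀

/-- `ψ(y)`, the maximizer of `x ↦ exp (-⟨x, y⟩) det x` (arbitrary if there is none). -/
def psi (y : Z) : Z := Classical.epsilon (IsMaximizer Z y)

/-- `δ(y) = (det ψ(y))⁻¹`. -/
def delta (y : Z) : ℝ := ((psi Z y : Matrix ι ι ℝ).det)⁻¹

/-- `S` is the Hessian operator of `-log δ` at `y`: the function `log δ` is twice continuously
differentiable at `y`, and `⟨S u, v⟩ = -∂²/∂s∂t log δ(y + s u + t v)` at `s = t = 0`. -/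
def IsHessianOperator (y : Z) (S : Z →ₗ[ℝ] Z) : Prop :=
  ContDiffAt ℝ 2 (fun z : Z => Real.log (delta Z z)) y ∧
    ∀ u v : Z, pairing (S u : Matrix ι ι ℝ) v =
      -deriv (fun s : ℝ => deriv (fun t : ℝ => Real.log (delta Z (y + s • u + t • v))) 0) 0

/-- `S(y)`, the Hessian operator of `-log δ` at `y` (arbitrary if there is none). -/
def hessianOperator (y : Z) : Z →ₗ[ℝ] Z := Classical.epsilon (IsHessianOperator Z y)

/-- `φ(y) = (det S(y)) ^ (1/2)`. -/
def phi (y : Z) : ℝ := Real.sqrt (LinearMap.det (hessianOperator Z y))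

/-- `γ(α)`, the integral of `exp (-tr x) (det x) ^ α` over the positive definite matrices in `Z`,
for the Lebesgue measure normalized by the trace inner product. -/
def gammaInt (α : ℝ) : ℝ :=
  ∫ x in posCone Z, Real.exp (-(x : Matrix ι ι ℝ).trace) * (x : Matrix ι ι ℝ).det ^ α

end General

section Blocks

/-! ### Block matrix spaces

Square matrices of size `n₁ + ⋯ + n_r`, divided into blocks, are indexed by `Σ k, Fin (n k)`.
Of a family `V l k` only the members with `k < l` are used. -/

variable {r : ℕ} {n : Fin r → ℕ}

/-- The block of `x` in block row `l` and block column `k`. -/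
def block (x : Matrix (Σ k, Fin (n k)) (Σ k, Fin (n k)) ℝ) (l k : Fin r) :
    Matrix (Fin (n l)) (Fin (n k)) ℝ :=
  x.submatrix (fun i => ⟨l, i⟩) (fun j => ⟨k, j⟩)

/-- The axioms (V1), (V2), (V3). -/
structure IsAdmissible (V : ∀ l k : Fin r, Submodule ℝ (Matrix (Fin (n l)) (Fin (n k)) ℝ)) :
    Prop where
  V1 : ∀ k l, k < l → ∀ A ∈ V l k, ∃ c : ℝ, A * Aᵀ = c • (1 : Matrix (Fin (n l)) (Fin (n l)) ℝ)
  V2 : ∀ j k l, j < k → k < l → ∀ A ∈ V l j, ∀ B ∈ V k j, A * Bᵀ ∈ V l k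
  V3 : ∀ j k l, j < k → k < l → ∀ A ∈ V l k, ∀ B ∈ V k j, A * B ∈ V l j

/-- The space of symmetric matrices whose diagonal blocks are multiples of the identity and whose
block in position `(l, k)` lies in `V l k` for `k < l`. -/
def blockSpace (V : ∀ l k : Fin r, Submodule ℝ (Matrix (Fin (n l)) (Fin (n k)) ℝ)) :
    Submodule ℝ (Matrix (Σ k, Fin (n k)) (Σ k, Fin (n k)) ℝ) where
  carrier := {x | x.IsSymm ∧
    (∀ k, ∃ c : ℝ, block x k k = c • (1 : Matrix (Fin (n k)) (Fin (n k)) ℝ)) ∧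
    ∀ k l, k < l → block x l k ∈ V l k}
  add_mem' := by
    rintro x y ⟨hx, hx', hx''⟩ ⟨hy, hy', hy''⟩
    refine ⟨hx.add hy, fun k => ?_, fun k l h => (V l k).add_mem (hx'' k l h) (hy'' k l h)⟩
    obtain ⟨a, ha⟩ := hx' k
    obtain ⟨b, hb⟩ := hy' k
    refine ⟨a + b, ?_⟩
    rw [add_smul, ← ha, ← hb]
    rfl
  zero_mem' := by
    refine ⟨Matrix.isSymm_zero, fun k => ⟨0, ?_⟩, fun k l _ => (V l k).zero_mem⟩
    rw [zero_smul]
    rfl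
  smul_mem' := by
    rintro c x ⟨hx, hx', hx''⟩
    refine ⟨hx.smul c, fun k => ?_, fun k l h => (V l k).smul_mem c (hx'' k l h)⟩
    obtain ⟨a, ha⟩ := hx' k
    refine ⟨c * a, ?_⟩
    rw [mul_smul, ← ha]
    rfl

/-- `q_k`, the sum of `dim V l k` over `l > k`. -/
def colDim (V : ∀ l k : Fin r, Submodule ℝ (Matrix (Fin (n l)) (Fin (n k)) ℝ)) (k : Fin r) : ℕ :=
  ∑ l ∈ Finset.Ioi k, Module.finrank ℝ (V l k)

end Blocks

end MatrixCone

end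

/-!
For `x₀` in the cone of positive definite matrices of a space `Z` of symmetric matrices, let `y` be
the orthogonal projection of `x₀⁻¹` onto `Z` (`invProj`).  On `Z` the pairing with `y` is
`u ↦ tr (x₀⁻¹ u)`, and since `det A ≤ exp (tr A - p)` with equality only at `A = 1`, the point `x₀`
is the only maximizer at `y`.  Conversely, at a point `y` of the dual cone a maximizer exists,
because `exp (-⟨x, y⟩)` decays exponentially on the closed cone and `det` vanishes on its
boundary, and the first-order condition says that `y` is the projection of its inverse.
So `ψ` inverts `invProj` and is smooth by the inverse function theorem.  The gradient of `log δ` is `ψ` (an envelope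
argument), hence `S(y)` is the inverse of `M : u ↦ π (x₀⁻¹ u x₀⁻¹)`, where `π` is the projection
onto `Z` (`isHessianOperator_iff`).

If `x₀ = T Tᵀ` and the congruence `ρ u = T u Tᵀ` preserves `Z`, then `ρ* M ρ = 1`, so
`φ(y) = |det ρ|` (`phi_invProj`); as `⟨ρ u, y⟩ = tr u` and `det (ρ u) = det x₀ · det u`, the
substitution `x = ρ u` gives the factorization formula (`integral_exp_neg_pairing`).

For a block space, the block triangular matrices with blocks in `V` are closed under products
by (V3), and `A ↦ A Aᵀ` maps them into the space by (V1) and (V2); polarization shows that they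
act on the space by congruence (`IsLower.congr_mem`).  Every positive definite `x` in the
space is `T Tᵀ` with `T` triangular: with first diagonal block `c • 1` and first block column `b`, the Schur
complement `x' - c⁻¹ b bᵀ` lies in the block space of size `r - 1`, and one proceeds by induction
(`exists_isLower_mul_transpose`).  The same splitting computes the gamma integral
(`gammaLInt_succ`): translating `x'` by `c⁻¹ b bᵀ` leaves a Gaussian integral in `b`, an Euler
integral in `c`, and the gamma integral of the smaller space.
-/

open MeasureTheory Matrix
open scoped Matrix.Norms.Frobenius

namespace MatrixCone

open Filter Topology

/-! ### Determinant and trace of positive definite matrices -/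

section PosDef

variable {ι : Type*} [Fintype ι] [DecidableEq ι]

open scoped MatrixOrder in
theorem exists_isUnit_mul_transpose {x : Matrix ι ι ℝ}
    (hx : x.PosDef) : ∃ B : Matrix ι ι ℝ, IsUnit B ∧ x = B * Bᵀ := by
  obtain ⟨B, hB⟩ := CStarAlgebra.nonneg_iff_eq_star_mul_self.mp hx.posSemidef.nonneg
  rw [star_eq_conjTranspose, conjTranspose_eq_transpose_of_trivial] at hB
  refine ⟨Bᵀ, ?_, by simpa using hB⟩
  have h := hx.det_pos
  rw [hB, det_mul] at h
  rw [isUnit_iff_isUnit_det]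
  exact (left_ne_zero_of_mul h.ne').isUnit

/-- The inequality `t ≤ exp (t - 1)`, strict for `t ≠ 1`, applied to the eigenvalues. -/
theorem det_le_exp_trace_sub {A : Matrix ι ι ℝ}
    (hA : A.PosDef) : A.det ≤ Real.exp (A.trace - Fintype.card ι) ∧
      (A.det = Real.exp (A.trace - Fintype.card ι) → A = 1) := by
  have hdet : A.det = ∏ i, hA.1.eigenvalues i := by simpa using hA.1.det_eq_prod_eigenvalues
  have htr : A.trace = ∑ i, hA.1.eigenvalues i := by simpa using hA.1.trace_eq_sum_eigenvalues
  have hpos := hA.eigenvalues_pos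
  have hexp : Real.exp (A.trace - Fintype.card ι) = ∏ i, Real.exp (hA.1.eigenvalues i - 1) := by
    rw [← Real.exp_sum, htr]; simp
  have hle : ∀ i, hA.1.eigenvalues i ≤ Real.exp (hA.1.eigenvalues i - 1) := fun i => by
    have := Real.add_one_le_exp (hA.1.eigenvalues i - 1); linarith
  rw [hexp, hdet]
  refine ⟨Finset.prod_le_prod (fun i _ => (hpos i).le) fun i _ => hle i, fun h => ?_⟩
  have h1 : ∀ i, hA.1.eigenvalues i = 1 := by
    by_contra! hne
    obtain ⟨i, hi⟩ := hne
    refine absurd h (Finset.prod_lt_prod (fun i _ => hpos i) (fun i _ => hle i)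
      ⟨i, Finset.mem_univ i, ?_⟩).ne
    have := Real.add_one_lt_exp (sub_ne_zero.2 hi); linarith
  rw [hA.1.spectral_theorem]
  have : (fun i => ((hA.1.eigenvalues i : ℝ))) = fun _ => 1 := funext h1
  simp [this]

/-- Among positive definite matrices, `x ↦ exp (-tr (x₀⁻¹ x)) det x` is maximal only at `x₀`. -/
theorem exp_neg_trace_mul_det_le {x₀ x : Matrix ι ι ℝ}
    (hx₀ : x₀.PosDef) (hx : x.PosDef) :
    Real.exp (-(x₀⁻¹ * x).trace) * x.det ≤ Real.exp (-(x₀⁻¹ * x₀).trace) * x₀.det ∧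
    (Real.exp (-(x₀⁻¹ * x).trace) * x.det = Real.exp (-(x₀⁻¹ * x₀).trace) * x₀.det → x = x₀) := by
  obtain ⟨B, hB, rfl⟩ := exists_isUnit_mul_transpose hx₀
  obtain ⟨u, rfl⟩ := hB
  -- With `x₀ = B Bᵀ` and `C = B⁻¹`, the claim is the inequality `det A ≤ exp (tr A - p)` for
  -- `A = C x Cᵀ`.
  set C : Matrix ι ι ℝ := (↑u⁻¹ : Matrix ι ι ℝ) with hC
  have hCB : C * u = 1 := u.inv_mul
  have hBC : u * C = 1 := u.mul_inv
  have hBC' : (u : Matrix ι ι ℝ)ᵀ * Cᵀ = 1 := by rw [← transpose_mul, hCB, transpose_one]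
  have hCB' : Cᵀ * (u : Matrix ι ι ℝ)ᵀ = 1 := by rw [← transpose_mul, hBC, transpose_one]
  set A := C * x * Cᵀ with hA
  have hxA : x = u * A * (u : Matrix ι ι ℝ)ᵀ := by
    rw [hA]
    calc x = (u * C) * x * (Cᵀ * (u : Matrix ι ι ℝ)ᵀ) := by rw [hBC, hCB']; simp
      _ = _ := by simp only [Matrix.mul_assoc]
  have hApd : A.PosDef := by
    have := (IsUnit.posDef_star_right_conjugate_iff (U := C) (x := x) ⟨u⁻¹, rfl⟩).2 hx
    rwa [star_eq_conjTranspose, conjTranspose_eq_transpose_of_trivial] at this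
  have hinv : ((u : Matrix ι ι ℝ) * (u : Matrix ι ι ℝ)ᵀ)⁻¹ = Cᵀ * C := by
    refine inv_eq_left_inv ?_
    calc Cᵀ * C * (u * (u : Matrix ι ι ℝ)ᵀ) = Cᵀ * (C * u) * (u : Matrix ι ι ℝ)ᵀ := by
          simp only [Matrix.mul_assoc]
      _ = 1 := by rw [hCB, Matrix.mul_one, hCB']
  have htr : (((u : Matrix ι ι ℝ) * (u : Matrix ι ι ℝ)ᵀ)⁻¹ * x).trace = A.trace := by
    rw [hinv, Matrix.mul_assoc, trace_mul_comm, ← hA]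
  have htr0 : (((u : Matrix ι ι ℝ) * (u : Matrix ι ι ℝ)ᵀ)⁻¹ * (u * (u : Matrix ι ι ℝ)ᵀ)).trace
      = Fintype.card ι := by
    rw [nonsing_inv_mul _ hx₀.det_pos.ne'.isUnit, trace_one]
  have hdet : x.det = A.det * ((u : Matrix ι ι ℝ) * (u : Matrix ι ι ℝ)ᵀ).det := by
    rw [hxA]; simp only [det_mul]; ring
  obtain ⟨h1, h2⟩ := det_le_exp_trace_sub hApd
  have hp := hx₀.det_pos
  have key : Real.exp (-A.trace) * x.det = (Real.exp (-A.trace) * A.det) *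
      ((u : Matrix ι ι ℝ) * (u : Matrix ι ι ℝ)ᵀ).det := by rw [hdet]; ring
  have hexp : Real.exp (A.trace - Fintype.card ι)
      = Real.exp (A.trace) * Real.exp (-(Fintype.card ι : ℝ)) := by
    rw [← Real.exp_add, sub_eq_add_neg]
  have hee : Real.exp (-A.trace) * Real.exp (A.trace) = 1 := by
    rw [← Real.exp_add]; simp
  rw [htr, htr0, key]
  rw [hexp] at h1 h2
  constructor
  · refine mul_le_mul_of_nonneg_right ?_ hp.le
    calc _ ≤ Real.exp (-A.trace) * (Real.exp (A.trace) * Real.exp (-(Fintype.card ι : ℝ))) :=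
          mul_le_mul_of_nonneg_left h1 (Real.exp_pos _).le
      _ = _ := by rw [← mul_assoc, hee, one_mul]
  · intro h
    have h3 := mul_right_cancel₀ hp.ne' h
    have h4 : A = 1 := h2 (by rw [← h3, ← mul_assoc, mul_comm (Real.exp A.trace), hee, one_mul])
    rw [hxA, h4, Matrix.mul_one]

end PosDef

/-! ### The cone of positive definite matrices and the maximizer -/

section Maximizer

variable {ι : Type*} [Fintype ι] {Z : Submodule ℝ (Matrix ι ι ℝ)}

theorem inner_eq_pairing (hZ : ∀ x ∈ Z, x.IsSymm) (x y : Z) :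
    inner ℝ x y = pairing (x : Matrix ι ι ℝ) y := by
  change ((x : Matrix ι ι ℝ)ᵀ * (y : Matrix ι ι ℝ)).trace = _
  rw [(hZ x x.2).eq]; rfl

theorem pairing_comm (x y : Matrix ι ι ℝ) : pairing x y = pairing y x := trace_mul_comm _ _

theorem eq_of_forall_pairing_eq (hZ : ∀ x ∈ Z, x.IsSymm) {x y : Z}
    (h : ∀ v : Z, pairing (v : Matrix ι ι ℝ) x = pairing (v : Matrix ι ι ℝ) y) : x = y := by
  refine ext_inner_left ℝ fun v => ?_
  rw [inner_eq_pairing hZ, inner_eq_pairing hZ, h]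

theorem isOpen_posCone (hZ : ∀ x ∈ Z, x.IsSymm) : IsOpen (posCone Z) := by
  have hh : ∀ x : Z, (x : Matrix ι ι ℝ).IsHermitian := fun x => by
    rw [IsHermitian, conjTranspose_eq_transpose_of_trivial]; exact hZ x x.2
  have hcont : Continuous fun q : Z × (ι → ℝ) => q.2 ⬝ᵥ ((q.1 : Matrix ι ι ℝ) *ᵥ q.2) := by
    have : Continuous fun q : Z × (ι → ℝ) => (q.1 : Matrix ι ι ℝ) :=
      continuous_subtype_val.comp continuous_fst
    exact continuous_snd.dotProduct (this.matrix_mulVec continuous_snd)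
  rw [isOpen_iff_mem_nhds]
  intro x hx
  have hx' : (x : Matrix ι ι ℝ).PosDef := hx
  have := (isCompact_sphere (0 : ι → ℝ) 1).eventually_forall_of_forall_eventually (x₀ := x)
    (P := fun z v => 0 < v ⬝ᵥ ((z : Matrix ι ι ℝ) *ᵥ v)) (fun v hv => by
      refine (hcont.tendsto (x, v)).eventually_const_lt ?_
      have hv0 : v ≠ 0 := by rintro rfl; simp at hv
      simpa using hx'.dotProduct_mulVec_pos hv0)
  filter_upwards [this] with z hz
  refine PosDef.of_dotProduct_mulVec_pos (hh z) fun v hv => ?_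
  have hv' : 0 < ‖v‖ := norm_pos_iff.2 hv
  have h1 := hz (‖v‖⁻¹ • v) (by simp [norm_smul, hv'.ne'])
  simp only [mulVec_smul, dotProduct_smul, smul_dotProduct, smul_eq_mul] at h1
  have h2 : 0 < ‖v‖⁻¹ := inv_pos.2 hv'
  simpa [h2] using h1

theorem posSemidef_of_mem_closure_posCone (hZ : ∀ x ∈ Z, x.IsSymm) {x : Z}
    (hx : x ∈ closure (posCone Z)) : (x : Matrix ι ι ℝ).PosSemidef := by
  have hh : ∀ x : Z, (x : Matrix ι ι ℝ).IsHermitian := fun x => by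
    rw [IsHermitian, conjTranspose_eq_transpose_of_trivial]; exact hZ x x.2
  have hc : IsClosed {z : Z | ∀ v : ι → ℝ, 0 ≤ v ⬝ᵥ ((z : Matrix ι ι ℝ) *ᵥ v)} := by
    simp only [Set.ofPred_forall]
    refine isClosed_iInter fun v => isClosed_le continuous_const ?_
    exact continuous_const.dotProduct (continuous_subtype_val.matrix_mulVec continuous_const)
  refine PosSemidef.of_dotProduct_mulVec_nonneg (hh x) fun v => ?_
  refine closure_minimal (fun z hz v => ?_) hc hx v
  simpa using (PosDef.posSemidef (M := (z : Matrix ι ι ℝ)) hz).dotProduct_mulVec_nonneg v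

theorem tendsto_norm_pow_mul_exp_neg_cocompact (E : Type*) [NormedAddCommGroup E] [ProperSpace E]
    (m : ℕ) {c : ℝ} (hc : 0 < c) :
    Tendsto (fun x : E => ‖x‖ ^ m * Real.exp (-c * ‖x‖)) (cocompact E) (𝓝 0) := by
  refine ((tendsto_rpow_mul_exp_neg_mul_atTop_nhds_zero m c hc).comp
    (tendsto_norm_cocompact_atTop (E := E))).congr fun x => ?_
  simp only [Function.comp_apply, Real.rpow_natCast]

theorem continuous_pairing_right (y : Matrix ι ι ℝ) :
    Continuous fun x : Z => pairing (x : Matrix ι ι ℝ) y :=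
  (continuous_subtype_val.matrix_mul continuous_const).matrix_trace

/-- On the closed cone, the pairing with an element of the dual cone dominates the norm. -/
theorem exists_le_pairing_of_mem_dualCone {y : Z} (hy : y ∈ dualCone Z) :
    ∃ c > 0, ∀ x ∈ closure (posCone Z), ‖x‖ = 1 → c ≤ pairing (x : Matrix ι ι ℝ) y := by
  have hcp := continuous_pairing_right (Z := Z) (y : Matrix ι ι ℝ)
  have hK : IsCompact (closure (posCone Z) ∩ Metric.sphere 0 1) :=
    (isCompact_sphere (0 : Z) 1).inter_left isClosed_closure
  rcases (closure (posCone Z) ∩ Metric.sphere 0 1).eq_empty_or_nonempty with h | h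
  · refine ⟨1, one_pos, fun x hx h1 => ?_⟩
    exact absurd (show x ∈ closure (posCone Z) ∩ Metric.sphere 0 1 from
      ⟨hx, mem_sphere_zero_iff_norm.2 h1⟩)
      (by rw [h]; exact Set.notMem_empty x)
  · obtain ⟨x, hx, hmin⟩ := hK.exists_isMinOn h hcp.continuousOn
    have hx1 : ‖x‖ = 1 := mem_sphere_zero_iff_norm.1 hx.2
    refine ⟨_, hy x hx.1 (by rintro rfl; rw [norm_zero] at hx1; exact zero_ne_one hx1),
      fun z hz h1 => ?_⟩
    exact hmin ⟨hz, mem_sphere_zero_iff_norm.2 h1⟩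

variable [DecidableEq ι]

/-- The function `x ↦ exp (-⟨x, y⟩) det x` tends to zero at infinity on the closed cone, so it
attains its maximum there; at the maximum `det x > 0`, which puts the maximizer into the open
cone. -/
theorem exists_isMaximizer (hZ : ∀ x ∈ Z, x.IsSymm) (hne : (posCone Z).Nonempty) {y : Z}
    (hy : y ∈ dualCone Z) : ∃ x, IsMaximizer Z y x := by
  have hcp := continuous_pairing_right (Z := Z) (y : Matrix ι ι ℝ)
  have hcd : Continuous fun x : Z => (x : Matrix ι ι ℝ).det := continuous_subtype_val.matrix_det
  have hcone : ∀ x ∈ closure (posCone Z), ∀ c : ℝ, 0 < c → c • x ∈ closure (posCone Z) := by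
    intro x hx c hc
    refine map_mem_closure (continuous_const_smul c) hx fun z hz => ?_
    exact PosDef.smul hz hc
  obtain ⟨x₁, hx₁⟩ := hne
  obtain ⟨c, hc, hcle⟩ := exists_le_pairing_of_mem_dualCone hy
  obtain ⟨K, hK⟩ : ∃ K : ℝ, ∀ x : Z, ‖x‖ = 1 → (x : Matrix ι ι ℝ).det ≤ K := by
    obtain ⟨K, hK⟩ := (isCompact_sphere (0 : Z) 1).bddAbove_image hcd.continuousOn
    exact ⟨K, fun x hx => hK ⟨x, mem_sphere_zero_iff_norm.2 hx, rfl⟩⟩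
  set f : Z → ℝ := fun x =>
    Real.exp (-pairing (x : Matrix ι ι ℝ) y) * (x : Matrix ι ι ℝ).det with hf
  have hbound : ∀ x ∈ closure (posCone Z), x ≠ 0 →
      f x ≤ |K| * (‖x‖ ^ (Fintype.card ι) * Real.exp (-c * ‖x‖)) := by
    intro x hx h0
    have hn : 0 < ‖x‖ := norm_pos_iff.2 h0
    set u := ‖x‖⁻¹ • x with hu
    have hu1 : ‖u‖ = 1 := by
      rw [hu, norm_smul, norm_inv, norm_norm, inv_mul_cancel₀ hn.ne']
    have hxu : x = ‖x‖ • u := by rw [hu, smul_smul, mul_inv_cancel₀ hn.ne', one_smul]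
    have huc := hcone x hx ‖x‖⁻¹ (inv_pos.2 hn)
    have h1 : (x : Matrix ι ι ℝ).det ≤ ‖x‖ ^ (Fintype.card ι) * |K| := by
      conv_lhs => rw [hxu]
      rw [Submodule.coe_smul, det_smul]
      exact mul_le_mul_of_nonneg_left ((hK u hu1).trans (le_abs_self K)) (by positivity)
    have h2 : c * ‖x‖ ≤ pairing (x : Matrix ι ι ℝ) y := by
      conv_rhs => rw [hxu]
      have := mul_le_mul_of_nonneg_right (hcle u huc hu1) hn.le
      rw [Submodule.coe_smul, pairing, Matrix.smul_mul, trace_smul, smul_eq_mul]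
      rw [mul_comm c, mul_comm ‖x‖ (trace _), mul_comm ‖x‖ c]
      exact this
    calc f x ≤ Real.exp (-c * ‖x‖) * (‖x‖ ^ (Fintype.card ι) * |K|) := by
          refine mul_le_mul (Real.exp_le_exp.2 (by linarith)) h1 ?_ (Real.exp_pos _).le
          exact (posSemidef_of_mem_closure_posCone hZ hx).det_nonneg
      _ = _ := by ring
  have hpos : 0 < f x₁ := mul_pos (Real.exp_pos _) (PosDef.det_pos (A := (x₁ : Matrix ι ι ℝ)) hx₁)
  obtain ⟨x, hx, hmax⟩ := ContinuousOn.exists_isMaxOn' (s := closure (posCone Z)) (f := f)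
    ((Real.continuous_exp.comp hcp.neg).mul hcd).continuousOn isClosed_closure
    (subset_closure hx₁) (by
      have ht : Tendsto (fun x : Z => |K| * (‖x‖ ^ (Fintype.card ι) * Real.exp (-c * ‖x‖)))
          (cocompact Z) (𝓝 0) := by
        have h1 := (tendsto_norm_pow_mul_exp_neg_cocompact Z (Fintype.card ι) hc).const_mul |K|
        rwa [mul_zero] at h1
      have h0 : ∀ᶠ x : Z in cocompact Z, x ≠ 0 := by
        have := (isCompact_singleton (x := (0 : Z))).compl_mem_cocompact
        filter_upwards [this] with x hx using hx
      rw [eventually_inf_principal]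
      filter_upwards [h0, ht.eventually_lt_const hpos] with x hx0 hxl hxc
      exact (hbound x hxc hx0).trans hxl.le)
  have hfx : 0 < f x := hpos.trans_le (hmax (subset_closure hx₁))
  have hdet : (x : Matrix ι ι ℝ).det ≠ 0 := (pos_of_mul_pos_right hfx (Real.exp_pos _).le).ne'
  exact ⟨x, (posSemidef_of_mem_closure_posCone hZ hx).posDef_iff_det_ne_zero.2 hdet,
    fun z hz => hmax (subset_closure hz)⟩

theorem IsMaximizer.le {y x₀ x : Z} (h : IsMaximizer Z y x₀) (hx : x ∈ posCone Z) :
    Real.exp (-pairing (x : Matrix ι ι ℝ) y) * (x : Matrix ι ι ℝ).det ≤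
      Real.exp (-pairing (x₀ : Matrix ι ι ℝ) y) * (x₀ : Matrix ι ι ℝ).det :=
  h.2 hx

/-- The first-order condition at a maximizer. -/
theorem pairing_eq_of_isMaximizer (hZ : ∀ x ∈ Z, x.IsSymm) {y x₀ : Z}
    (h : IsMaximizer Z y x₀) (v : Z) :
    pairing (v : Matrix ι ι ℝ) y = ((x₀ : Matrix ι ι ℝ)⁻¹ * v).trace := by
  have hpd : (x₀ : Matrix ι ι ℝ).PosDef := h.1
  have hu := hpd.det_pos.ne'.isUnit
  set A := (x₀ : Matrix ι ι ℝ)⁻¹ * v with hA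
  -- Along a line, `det (1 + t A) = 1 + tr A t + P(t) t ^ 2`.
  set P := Polynomial.divX (Polynomial.divX
    (det (1 + (Polynomial.X : Polynomial ℝ) • A.map Polynomial.C)))
  set f : ℝ → ℝ := fun t => Real.exp (-pairing ((x₀ + t • v : Z) : Matrix ι ι ℝ) y) *
      ((x₀ + t • v : Z) : Matrix ι ι ℝ).det with hf
  have hf' : f = fun t =>
      Real.exp (-pairing (x₀ : Matrix ι ι ℝ) y - t * pairing (v : Matrix ι ι ℝ) y) *
      ((x₀ : Matrix ι ι ℝ).det * (1 + A.trace * t + P.eval t * t ^ 2)) := by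
    funext t
    have h1 : ((x₀ + t • v : Z) : Matrix ι ι ℝ) = x₀ * (1 + t • A) := by
      rw [Matrix.mul_add, Matrix.mul_one, Matrix.mul_smul, hA, ← Matrix.mul_assoc,
        mul_nonsing_inv _ hu, Matrix.one_mul]; rfl
    have h2 : pairing ((x₀ + t • v : Z) : Matrix ι ι ℝ) y
        = pairing (x₀ : Matrix ι ι ℝ) y + t * pairing (v : Matrix ι ι ℝ) y := by
      simp [pairing, Matrix.add_mul]
    rw [hf]
    simp only [h2]
    rw [h1, det_mul, det_one_add_smul]
    congr 2; ring
  have hmax : IsLocalMax f 0 := by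
    have hc : Tendsto (fun t : ℝ => x₀ + t • v) (𝓝 0) (𝓝 x₀) := by
      have : Continuous (fun t : ℝ => x₀ + t • v) := by fun_prop
      simpa using this.tendsto 0
    filter_upwards [hc ((isOpen_posCone hZ).mem_nhds h.1)] with t ht
    simpa only [hf, zero_smul, add_zero] using h.le ht
  have hd : HasDerivAt f (Real.exp (-pairing (x₀ : Matrix ι ι ℝ) y) * (x₀ : Matrix ι ι ℝ).det *
      (A.trace - pairing (v : Matrix ι ι ℝ) y)) 0 := by
    rw [hf']
    have h1 : HasDerivAt (fun t : ℝ =>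
        Real.exp (-pairing (x₀ : Matrix ι ι ℝ) y - t * pairing (v : Matrix ι ι ℝ) y)) _ 0 :=
      (((hasDerivAt_id (0:ℝ)).mul_const _).const_sub _).exp
    have h2 : HasDerivAt (fun t : ℝ =>
        (x₀ : Matrix ι ι ℝ).det * (1 + A.trace * t + P.eval t * t ^ 2)) _ 0 :=
      ((((hasDerivAt_id (0:ℝ)).const_mul _).const_add _).add
        ((P.hasDerivAt 0).mul (hasDerivAt_pow 2 (0:ℝ)))).const_mul _
    refine (h1.mul h2).congr_deriv ?_
    simp only [id, zero_mul, sub_zero, mul_zero, add_zero, one_mul, mul_one, zero_pow two_ne_zero,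
      Nat.add_one_sub_one, pow_one]
    ring
  have := hmax.hasDerivAt_eq_zero hd
  have hne : Real.exp (-pairing (x₀ : Matrix ι ι ℝ) y) * (x₀ : Matrix ι ι ℝ).det ≠ 0 :=
    mul_ne_zero (Real.exp_pos _).ne' hpd.det_pos.ne'
  have := (mul_eq_zero.1 this).resolve_left hne
  linarith

/-- The first-order condition is sufficient, and determines the maximizer. -/
theorem isMaximizer_unique_of_pairing_eq {y x₀ : Z} (hx₀ : x₀ ∈ posCone Z)
    (h : ∀ v : Z, pairing (v : Matrix ι ι ℝ) y = ((x₀ : Matrix ι ι ℝ)⁻¹ * v).trace) :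
    IsMaximizer Z y x₀ ∧ ∀ x, IsMaximizer Z y x → x = x₀ := by
  have key : ∀ x ∈ posCone Z, _ := fun x hx => exp_neg_trace_mul_det_le (x := x.1) hx₀ hx
  refine ⟨⟨hx₀, fun x hx => ?_⟩, fun x hx => ?_⟩
  · change Real.exp _ * _ ≤ Real.exp _ * _
    simpa only [h] using (key x hx).1
  · have h1 := hx.le hx₀
    rw [h x, h x₀] at h1
    exact Subtype.ext ((key x hx.1).2 (le_antisymm (key x hx.1).1 h1))

end Maximizer

/-! ### Smoothness of the maximizer and the Hessian of `log δ` -/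

section Hessian

variable {ι : Type*} [Fintype ι] [DecidableEq ι] (Z : Submodule ℝ (Matrix ι ι ℝ))

/-- The orthogonal projection onto `Z` of the inverse matrix `x⁻¹`. -/
noncomputable def invProj (x : Z) : Z := Z.orthogonalProjectionOnto ((x : Matrix ι ι ℝ)⁻¹)

/-- The operator `u ↦ π (x⁻¹ u x⁻¹)` on `Z`, where `π` is the orthogonal projection onto `Z`; it is
minus the derivative of `invProj Z` at `x`. -/
noncomputable def invQuad (x : Z) : Z →L[ℝ] Z :=
  Z.orthogonalProjectionOnto ∘L
    (ContinuousLinearMap.mulLeftRight ℝ (Matrix ι ι ℝ) (x : Matrix ι ι ℝ)⁻¹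
      (x : Matrix ι ι ℝ)⁻¹) ∘L Z.subtypeL

variable {Z}

theorem pairing_orthogonalProjection (hZ : ∀ x ∈ Z, x.IsSymm) (v : Z) (w : Matrix ι ι ℝ) :
    pairing (v : Matrix ι ι ℝ) (Z.orthogonalProjectionOnto w) = (w * v).trace := by
  rw [← inner_eq_pairing hZ, Submodule.inner_orthogonalProjectionOnto_eq_of_mem_left]
  change ((v : Matrix ι ι ℝ)ᵀ * w).trace = _
  rw [(hZ v v.2).eq, trace_mul_comm]

theorem pairing_invProj (hZ : ∀ x ∈ Z, x.IsSymm) (v x : Z) :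
    pairing (v : Matrix ι ι ℝ) (invProj Z x) = ((x : Matrix ι ι ℝ)⁻¹ * v).trace :=
  pairing_orthogonalProjection hZ v _

theorem pairing_invQuad (hZ : ∀ x ∈ Z, x.IsSymm) (x u v : Z) :
    pairing (v : Matrix ι ι ℝ) (invQuad Z x u) =
      ((x : Matrix ι ι ℝ)⁻¹ * u * (x : Matrix ι ι ℝ)⁻¹ * v).trace :=
  pairing_orthogonalProjection hZ v _

theorem invQuad_injective (hZ : ∀ x ∈ Z, x.IsSymm) {x : Z} (hx : x ∈ posCone Z) :
    Function.Injective (invQuad Z x) := by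
  rw [injective_iff_map_eq_zero]
  intro u hu
  have hpd : ((x : Matrix ι ι ℝ)⁻¹).PosDef := PosDef.inv hx
  obtain ⟨B, hB, hxB⟩ := exists_isUnit_mul_transpose hpd
  have h := pairing_invQuad hZ x u u
  rw [hu, hxB] at h
  -- The pairing `⟨u, invQuad u⟩` is the squared norm of `Bᵀ u B`, where `x⁻¹ = B Bᵀ`.
  have h0 : ((Bᵀ * (u : Matrix ι ι ℝ) * B) * (Bᵀ * (u : Matrix ι ι ℝ) * B)ᴴ).trace = 0 := by
    rw [conjTranspose_eq_transpose_of_trivial]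
    simp only [transpose_mul, transpose_transpose, (hZ u u.2).eq]
    calc _ = (Bᵀ * ((u : Matrix ι ι ℝ) * B * (Bᵀ * u * B))).trace := by simp only [Matrix.mul_assoc]
      _ = ((u : Matrix ι ι ℝ) * B * (Bᵀ * u * B) * Bᵀ).trace := trace_mul_comm _ _
      _ = ((u : Matrix ι ι ℝ) * (B * Bᵀ * u * (B * Bᵀ))).trace := by simp only [Matrix.mul_assoc]
      _ = (B * Bᵀ * u * (B * Bᵀ) * u).trace := trace_mul_comm _ _
      _ = 0 := by rw [← h]; simp [pairing]
  have h1 := trace_mul_conjTranspose_self_eq_zero_iff.1 h0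
  have hBt : IsUnit Bᵀ := by rwa [isUnit_transpose]
  rw [hB.mul_left_eq_zero, hBt.mul_right_eq_zero] at h1
  exact Subtype.ext h1

theorem hasStrictFDerivAt_invProj {x : Z} (hx : x ∈ posCone Z) :
    HasStrictFDerivAt (invProj Z) (-invQuad Z x) x := by
  obtain ⟨u, hu⟩ : IsUnit (x : Matrix ι ι ℝ) := PosDef.isUnit hx
  have h1 := hasStrictFDerivAt_ringInverse (𝕜 := ℝ) u
  have hinv : (↑u⁻¹ : Matrix ι ι ℝ) = (x : Matrix ι ι ℝ)⁻¹ := by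
    rw [nonsing_inv_eq_ringInverse, ← hu, Ring.inverse_unit]
  rw [hinv, hu] at h1
  have h2 := (Z.orthogonalProjectionOnto.hasStrictFDerivAt).comp x
    (HasStrictFDerivAt.comp x (f := Z.subtypeL) h1 Z.subtypeL.hasStrictFDerivAt)
  have hf : invProj Z = (Z.orthogonalProjectionOnto) ∘ Ring.inverse ∘ Z.subtypeL := by
    funext z
    simp [invProj, nonsing_inv_eq_ringInverse]
  rw [hf]
  refine h2.congr_fderiv ?_
  ext1 v
  exact map_neg Z.orthogonalProjectionOnto _

theorem contDiffAt_invProj {x : Z} (hx : x ∈ posCone Z) : ContDiffAt ℝ 2 (invProj Z) x := by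
  obtain ⟨u, hu⟩ : IsUnit (x : Matrix ι ι ℝ) := PosDef.isUnit hx
  have h1 := contDiffAt_ringInverse ℝ (n := 2) u
  rw [hu] at h1
  have hf : invProj Z = (Z.orthogonalProjectionOnto) ∘ Ring.inverse ∘ Z.subtypeL := by
    funext z
    simp [invProj, nonsing_inv_eq_ringInverse]
  rw [hf]
  exact (Z.orthogonalProjectionOnto.contDiff.contDiffAt).comp x
    (ContDiffAt.comp x (f := Z.subtypeL) h1 Z.subtypeL.contDiff.contDiffAt)

theorem psi_invProj (hZ : ∀ x ∈ Z, x.IsSymm) {x : Z} (hx : x ∈ posCone Z) :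
    psi Z (invProj Z x) = x := by
  obtain ⟨h1, h2⟩ := isMaximizer_unique_of_pairing_eq hx (pairing_invProj hZ · x)
  exact h2 _ (Classical.epsilon_spec ⟨x, h1⟩)

theorem contDiff_det : ContDiff ℝ 2 fun x : Z => (x : Matrix ι ι ℝ).det := by
  have h : ∀ i j, ContDiff ℝ 2 fun x : Z => (x : Matrix ι ι ℝ) i j := fun i j =>
    (LinearMap.toContinuousLinearMap ((entryLinearMap ℝ ℝ i j).comp Z.subtype)).contDiff
  simp only [det_apply']
  exact ContDiff.sum fun σ _ => contDiff_const.mul (contDiff_prod fun i _ => h _ _)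

/-- The operator `invQuad Z x` as a continuous linear equivalence. -/
noncomputable def invQuadEquiv (hZ : ∀ x ∈ Z, x.IsSymm) {x : Z} (hx : x ∈ posCone Z) : Z ≃L[ℝ] Z :=
  (LinearEquiv.ofInjectiveEndo (invQuad Z x : Z →ₗ[ℝ] Z)
    (invQuad_injective hZ hx)).toContinuousLinearEquiv

@[simp]
theorem invQuadEquiv_apply (hZ : ∀ x ∈ Z, x.IsSymm) {x : Z} (hx : x ∈ posCone Z) (u : Z) :
    invQuadEquiv hZ hx u = invQuad Z x u := rfl

/-- Near `invProj Z x`, the map `ψ` is the local inverse of `invProj Z` given by the inverse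
function theorem. -/
theorem psi_invProj_smooth (hZ : ∀ x ∈ Z, x.IsSymm) {x : Z} (hx : x ∈ posCone Z) :
    (∀ᶠ z in 𝓝 (invProj Z x), ∃ x' ∈ posCone Z, invProj Z x' = z) ∧
    ContDiffAt ℝ 2 (psi Z) (invProj Z x) ∧
    HasFDerivAt (psi Z) (-((invQuadEquiv hZ hx).symm : Z →L[ℝ] Z)) (invProj Z x) := by
  have hc := contDiffAt_invProj hx
  -- The derivative of `invProj Z` at `x`.
  set e : Z ≃L[ℝ] Z := (invQuadEquiv hZ hx).trans (ContinuousLinearEquiv.neg ℝ) with he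
  have hs : HasStrictFDerivAt (invProj Z) (e : Z →L[ℝ] Z) x := by
    refine (hasStrictFDerivAt_invProj hx).congr_fderiv ?_
    ext1 v
    simp [he]
  have h2 : (2 : WithTop ℕ∞) ≠ 0 := two_ne_zero
  have hg := hc.to_localInverse hs.hasFDerivAt h2
  set g := hc.localInverse hs.hasFDerivAt h2
  have hgd : HasStrictFDerivAt g (e.symm : Z →L[ℝ] Z) (invProj Z x) :=
    (hc.hasStrictFDerivAt' hs.hasFDerivAt h2).to_localInverse
  have hgx : g (invProj Z x) = x :=
    (hc.hasStrictFDerivAt' hs.hasFDerivAt h2).localInverse_apply_image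
  have hr : ∀ᶠ z in 𝓝 (invProj Z x), invProj Z (g z) = z :=
    (hc.hasStrictFDerivAt' hs.hasFDerivAt h2).eventually_right_inverse
  have hp : ∀ᶠ z in 𝓝 (invProj Z x), g z ∈ posCone Z := by
    refine hgd.continuousAt.eventually_mem ?_
    rw [hgx]
    exact (isOpen_posCone hZ).mem_nhds hx
  have heq : psi Z =ᶠ[𝓝 (invProj Z x)] g := by
    filter_upwards [hr, hp] with z h3 h4
    rw [← psi_invProj hZ h4, h3]
  refine ⟨?_, hg.congr_of_eventuallyEq heq, ?_⟩
  · filter_upwards [hr, hp] with z h3 h4 using ⟨g z, h4, h3⟩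
  · refine (hgd.hasFDerivAt.congr_of_eventuallyEq heq).congr_fderiv ?_
    ext1 v
    refine e.injective ?_
    change e (e.symm v) = -(invQuadEquiv hZ hx (-(invQuadEquiv hZ hx).symm v))
    rw [map_neg, e.apply_symm_apply, ContinuousLinearEquiv.apply_symm_apply, neg_neg]

/-- The gradient of `log δ` is `ψ`: the function `z ↦ log δ(z) - ⟨ψ(y), z⟩` has a local maximum at
`y`. -/
theorem hasFDerivAt_log_delta (hZ : ∀ x ∈ Z, x.IsSymm) {x : Z} (hx : x ∈ posCone Z) :
    ContDiffAt ℝ 2 (fun z : Z => Real.log (delta Z z)) (invProj Z x) ∧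
    HasFDerivAt (fun z : Z => Real.log (delta Z z)) (innerSL ℝ x) (invProj Z x) := by
  obtain ⟨hev, hc, -⟩ := psi_invProj_smooth hZ hx
  have hpx := psi_invProj hZ hx
  have hdet : (x : Matrix ι ι ℝ).det ≠ 0 := (PosDef.det_pos (A := (x : Matrix ι ι ℝ)) hx).ne'
  have hcd : ContDiffAt ℝ 2 (fun z : Z => Real.log (delta Z z)) (invProj Z x) := by
    have h1 : ContDiffAt ℝ 2 (fun z : Z => (psi Z z : Matrix ι ι ℝ).det) (invProj Z x) :=
      contDiff_det.contDiffAt.comp (invProj Z x) hc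
    have h0 : (psi Z (invProj Z x) : Matrix ι ι ℝ).det ≠ 0 := by rwa [hpx]
    exact (h1.inv h0).log (inv_ne_zero h0)
  refine ⟨hcd, ?_⟩
  have hd := hcd.differentiableAt two_ne_zero
  have hmax : IsLocalMax (fun z : Z => Real.log (delta Z z) - innerSL ℝ x z) (invProj Z x) := by
    filter_upwards [hev] with z hz
    obtain ⟨w, hw, rfl⟩ := hz
    have hm := (isMaximizer_unique_of_pairing_eq hw (pairing_invProj hZ · w)).1.le hx
    have hdw := PosDef.det_pos (A := (w : Matrix ι ι ℝ)) hw
    have hdx := PosDef.det_pos (A := (x : Matrix ι ι ℝ)) hx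
    rw [pairing_invProj hZ w w, nonsing_inv_mul _ hdw.ne'.isUnit] at hm
    have hl := Real.log_le_log (mul_pos (Real.exp_pos _) hdx) hm
    rw [Real.log_mul (Real.exp_pos _).ne' hdx.ne', Real.log_mul (Real.exp_pos _).ne' hdw.ne',
      Real.log_exp, Real.log_exp] at hl
    simp only [delta, psi_invProj hZ hw, hpx, Real.log_inv, innerSL_apply_apply,
      inner_eq_pairing hZ]
    rw [pairing_invProj hZ x x, nonsing_inv_mul _ hdx.ne'.isUnit]
    linarith
  have h0 := hmax.hasFDerivAt_eq_zero (hd.hasFDerivAt.sub (innerSL ℝ x).hasFDerivAt)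
  rw [← sub_eq_zero.1 h0]
  exact hd.hasFDerivAt

/-- The Hessian operator of `-log δ` at `invProj Z x` is the inverse of `invQuad Z x`. -/
theorem isHessianOperator_iff (hZ : ∀ x ∈ Z, x.IsSymm) {x : Z} (hx : x ∈ posCone Z)
    (S : Z →ₗ[ℝ] Z) :
    IsHessianOperator Z (invProj Z x) S ↔ S = ((invQuadEquiv hZ hx).symm : Z →L[ℝ] Z) := by
  obtain ⟨hev, -, hpsi⟩ := psi_invProj_smooth hZ hx
  set y := invProj Z x
  have hgrad : ∀ᶠ z in 𝓝 y,
      HasFDerivAt (fun z : Z => Real.log (delta Z z)) (innerSL ℝ (psi Z z)) z := by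
    filter_upwards [hev] with z hz
    obtain ⟨w, hw, rfl⟩ := hz
    rw [psi_invProj hZ hw]
    exact (hasFDerivAt_log_delta hZ hw).2
  have hHess : ∀ u v : Z,
      -deriv (fun s : ℝ => deriv (fun t : ℝ => Real.log (delta Z (y + s • u + t • v))) 0) 0 =
        inner ℝ ((invQuadEquiv hZ hx).symm u) v := by
    intro u v
    have hl : ∀ w u : Z, HasDerivAt (fun s : ℝ => w + s • u) u 0 := fun w u =>
      (((hasDerivAt_id (0 : ℝ)).smul_const u).const_add w).congr_deriv (one_smul ℝ u)
    have hlim : Tendsto (fun s : ℝ => y + s • u) (𝓝 0) (𝓝 y) := by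
      have := (hl y u).continuousAt.tendsto
      simp only [zero_smul, add_zero] at this
      exact this
    have h1 : (fun s : ℝ => deriv (fun t : ℝ => Real.log (delta Z (y + s • u + t • v))) 0)
        =ᶠ[𝓝 0] fun s => inner ℝ (psi Z (y + s • u)) v := by
      filter_upwards [hlim.eventually hgrad] with s hs
      have hs' : HasFDerivAt (fun z : Z => Real.log (delta Z z)) (innerSL ℝ (psi Z (y + s • u)))
          (y + s • u + (0 : ℝ) • v) := by simpa only [zero_smul, add_zero] using hs
      exact (hs'.comp_hasDerivAt (0 : ℝ) (hl _ v)).deriv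
    rw [h1.deriv_eq]
    have hpsi' : HasFDerivAt (psi Z) (-((invQuadEquiv hZ hx).symm : Z →L[ℝ] Z))
        (y + (0 : ℝ) • u) := by simpa only [zero_smul, add_zero] using hpsi
    have h2 : HasDerivAt (fun s : ℝ => psi Z (y + s • u)) (-(invQuadEquiv hZ hx).symm u) 0 := by
      have h := hpsi'.comp_hasDerivAt (0 : ℝ) (hl y u)
      exact h
    have h3 : HasDerivAt (fun s : ℝ => inner ℝ (psi Z (y + s • u)) v)
        (innerSL ℝ v (-(invQuadEquiv hZ hx).symm u)) 0 := by
      simp only [real_inner_comm v]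
      exact (innerSL ℝ v).hasFDerivAt.comp_hasDerivAt (0 : ℝ) h2
    rw [h3.deriv, map_neg, neg_neg, innerSL_apply_apply, real_inner_comm]
  refine ⟨fun h => ?_, fun h => ⟨(hasFDerivAt_log_delta hZ hx).1, fun u v => ?_⟩⟩
  · ext1 u
    refine ext_inner_right ℝ fun v => ?_
    rw [inner_eq_pairing hZ, h.2 u v, hHess]
    rfl
  · rw [hHess, h, inner_eq_pairing hZ]
    rfl

end Hessian

/-! ### Congruence by a matrix preserving the space -/

section Congruence

theorem _root_.LinearMap.det_adjoint_real {E : Type*} [NormedAddCommGroup E] [InnerProductSpace ℝ E]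
    [FiniteDimensional ℝ E] (f : E →ₗ[ℝ] E) :
    LinearMap.det (LinearMap.adjoint f) = LinearMap.det f := by
  rw [← LinearMap.det_toMatrix (stdOrthonormalBasis ℝ E).toBasis, LinearMap.toMatrix_adjoint,
    conjTranspose_eq_transpose_of_trivial, det_transpose, LinearMap.det_toMatrix]

variable {ι : Type*} [Fintype ι] {Z : Submodule ℝ (Matrix ι ι ℝ)}

/-- The linear map `x ↦ T x Tᵀ` of `Z`. -/
def congrMap (T : Matrix ι ι ℝ) (hT : ∀ x ∈ Z, T * x * Tᵀ ∈ Z) : Z →ₗ[ℝ] Z where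
  toFun x := ⟨T * x * Tᵀ, hT x x.2⟩
  map_add' x y := Subtype.ext (by simp [Matrix.mul_add, Matrix.add_mul])
  map_smul' c x := Subtype.ext (by simp)

variable [DecidableEq ι] {T : Matrix ι ι ℝ} (hT : ∀ x ∈ Z, T * x * Tᵀ ∈ Z)

theorem congrMap_injective (hTu : IsUnit T) : Function.Injective (congrMap T hT) := by
  rw [injective_iff_map_eq_zero]
  intro u hu
  have h1 : T * u * Tᵀ = 0 := congrArg Subtype.val hu
  have hTt : IsUnit Tᵀ := by rwa [isUnit_transpose]
  rw [hTt.mul_left_eq_zero, hTu.mul_right_eq_zero] at h1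
  exact Subtype.ext h1

theorem det_congrMap_ne_zero (hTu : IsUnit T) : LinearMap.det (congrMap T hT) ≠ 0 :=
  (LinearEquiv.isUnit_det' (LinearEquiv.ofInjectiveEndo _ (congrMap_injective hT hTu))).ne_zero

theorem preimage_congrMap_posCone (hTu : IsUnit T) :
    congrMap T hT ⁻¹' posCone Z = posCone Z := by
  ext x
  change (T * x * Tᵀ).PosDef ↔ (x : Matrix ι ι ℝ).PosDef
  have := IsUnit.posDef_star_right_conjugate_iff (x := (x : Matrix ι ι ℝ)) hTu
  rwa [star_eq_conjTranspose, conjTranspose_eq_transpose_of_trivial] at this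

theorem inv_mul_transpose_mul_congr (hTu : IsUnit T) (u : Matrix ι ι ℝ) :
    (T * Tᵀ)⁻¹ * (T * u * Tᵀ) = Tᵀ⁻¹ * u * Tᵀ := by
  have hTd : IsUnit T.det := (isUnit_iff_isUnit_det T).1 hTu
  rw [Matrix.mul_inv_rev]
  calc _ = Tᵀ⁻¹ * ((T⁻¹ * T) * u * Tᵀ) := by simp only [Matrix.mul_assoc]
    _ = _ := by rw [nonsing_inv_mul _ hTd, Matrix.one_mul, Matrix.mul_assoc]

theorem pairing_congr (hZ : ∀ x ∈ Z, x.IsSymm) (hTu : IsUnit T)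
    {x₀ : Z} (hx₀ : (x₀ : Matrix ι ι ℝ) = T * Tᵀ) (u : Z) :
    pairing (congrMap T hT u : Matrix ι ι ℝ) (invProj Z x₀) = (u : Matrix ι ι ℝ).trace := by
  have hTd : IsUnit Tᵀ.det := by rw [det_transpose]; exact (isUnit_iff_isUnit_det T).1 hTu
  rw [pairing_invProj hZ, hx₀]
  change ((T * Tᵀ)⁻¹ * (T * u * Tᵀ)).trace = _
  rw [inv_mul_transpose_mul_congr hTu, Matrix.mul_assoc, trace_mul_comm, Matrix.mul_assoc,
    mul_nonsing_inv _ hTd, Matrix.mul_one]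

/-- If `x₀ = T Tᵀ`, the operator `u ↦ π (x₀⁻¹ u x₀⁻¹)` is turned into the identity by the congruence
`u ↦ T u Tᵀ`. -/
theorem adjoint_congrMap_comp (hZ : ∀ x ∈ Z, x.IsSymm) (hTu : IsUnit T)
    {x₀ : Z} (hx₀ : (x₀ : Matrix ι ι ℝ) = T * Tᵀ) :
    LinearMap.adjoint (congrMap T hT) ∘ₗ (invQuad Z x₀ : Z →ₗ[ℝ] Z) ∘ₗ congrMap T hT =
      LinearMap.id := by
  have hTd : IsUnit Tᵀ.det := by rw [det_transpose]; exact (isUnit_iff_isUnit_det T).1 hTu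
  ext1 u
  refine ext_inner_left ℝ fun v => ?_
  simp only [LinearMap.comp_apply, LinearMap.adjoint_inner_right, LinearMap.id_apply]
  rw [inner_eq_pairing hZ, inner_eq_pairing hZ, pairing_comm (v : Matrix ι ι ℝ)]
  refine (pairing_invQuad hZ x₀ _ _).trans ?_
  rw [hx₀]
  change ((T * Tᵀ)⁻¹ * (T * u * Tᵀ) * (T * Tᵀ)⁻¹ * (T * v * Tᵀ)).trace = _
  rw [Matrix.mul_assoc _ (T * Tᵀ)⁻¹, inv_mul_transpose_mul_congr hTu,
    inv_mul_transpose_mul_congr hTu, pairing]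
  calc _ = (Tᵀ⁻¹ * (u * (Tᵀ * Tᵀ⁻¹) * v * Tᵀ)).trace := by simp only [Matrix.mul_assoc]
    _ = ((u : Matrix ι ι ℝ) * v * (Tᵀ * Tᵀ⁻¹)).trace := by
      rw [trace_mul_comm, mul_nonsing_inv _ hTd]
      simp only [Matrix.mul_assoc, Matrix.mul_one, mul_nonsing_inv _ hTd]
    _ = _ := by rw [mul_nonsing_inv _ hTd, Matrix.mul_one]

theorem phi_invProj (hZ : ∀ x ∈ Z, x.IsSymm) (hTu : IsUnit T) {x₀ : Z}
    (hx₀ : (x₀ : Matrix ι ι ℝ) = T * Tᵀ) (hp : x₀ ∈ posCone Z) :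
    phi Z (invProj Z x₀) = |LinearMap.det (congrMap T hT)| := by
  have hS : hessianOperator Z (invProj Z x₀) = ((invQuadEquiv hZ hp).symm : Z →L[ℝ] Z) :=
    (isHessianOperator_iff hZ hp _).1 (Classical.epsilon_spec
      (p := IsHessianOperator Z (invProj Z x₀)) ⟨_, (isHessianOperator_iff hZ hp _).2 rfl⟩)
  have h1 := congrArg LinearMap.det (adjoint_congrMap_comp hT hZ hTu hx₀)
  simp only [LinearMap.det_comp, LinearMap.det_id, LinearMap.det_adjoint_real] at h1
  have h2 : LinearMap.det ((invQuadEquiv hZ hp).symm : Z →L[ℝ] Z).toLinearMap *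
      LinearMap.det (invQuad Z x₀ : Z →ₗ[ℝ] Z) = 1 := by
    rw [← LinearMap.det_comp, ← LinearMap.det_id (A := ℝ) (M := Z)]
    congr 1
    ext1 u
    exact (invQuadEquiv hZ hp).symm_apply_apply u
  rw [phi, hS, ← Real.sqrt_sq_eq_abs]
  congr 1
  have h3 : LinearMap.det (invQuad Z x₀ : Z →ₗ[ℝ] Z) ≠ 0 := right_ne_zero_of_mul_eq_one h2
  refine mul_right_cancel₀ h3 (h2.trans ?_)
  rw [← h1]; ring

theorem delta_invProj (hZ : ∀ x ∈ Z, x.IsSymm) {x₀ : Z} (hp : x₀ ∈ posCone Z) (α : ℝ) :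
    delta Z (invProj Z x₀) ^ (-α) = (x₀ : Matrix ι ι ℝ).det ^ α := by
  have := PosDef.det_pos (A := (x₀ : Matrix ι ι ℝ)) hp
  rw [delta, psi_invProj hZ hp, Real.inv_rpow this.le, Real.rpow_neg this.le, inv_inv]

/-- The substitution `x = T u Tᵀ` turns the integral at `invProj Z (T Tᵀ)` into the one defining
`gammaInt`. -/
theorem integral_exp_neg_pairing (hT : ∀ x ∈ Z, T * x * Tᵀ ∈ Z) (hZ : ∀ x ∈ Z, x.IsSymm)
    (hTu : IsUnit T) {x₀ : Z} (hx₀ : (x₀ : Matrix ι ι ℝ) = T * Tᵀ) (hp : x₀ ∈ posCone Z)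
    {α : ℝ} (hint : IntegrableOn
        (fun x : Z => Real.exp (-x.1.trace) * x.1.det ^ α) (posCone Z)) :
    IntegrableOn
      (fun x : Z => Real.exp (-pairing x.1 (invProj Z x₀).1) * x.1.det ^ α) (posCone Z) ∧
    ∫ x in posCone Z, Real.exp (-pairing x.1 (invProj Z x₀).1) * x.1.det ^ α =
      gammaInt Z α * phi Z (invProj Z x₀) * delta Z (invProj Z x₀) ^ (-α) := by
  set R := congrMap T hT with hR
  set c := LinearMap.det R with hc
  have hc0 : c ≠ 0 := det_congrMap_ne_zero hT hTu
  have hpos := PosDef.det_pos (A := (x₀ : Matrix ι ι ℝ)) hp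
  set f : Z → ℝ := fun x => Real.exp (-pairing x.1 (invProj Z x₀).1) * x.1.det ^ α with hf
  have hmap : Measure.map R volume = ENNReal.ofReal |c⁻¹| • (volume : Measure Z) :=
    Measure.map_linearMap_addHaar_eq_smul_addHaar volume hc0
  have hemb : MeasurableEmbedding R :=
    (LinearEquiv.ofInjectiveEndo R
      (congrMap_injective hT hTu)).toContinuousLinearEquiv.toHomeomorph.measurableEmbedding
  have hfR : ∀ x ∈ posCone Z, f (R x) =
      (x₀ : Matrix ι ι ℝ).det ^ α * (Real.exp (-x.1.trace) * x.1.det ^ α) := by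
    intro x hx
    have hdx := PosDef.det_pos (A := (x : Matrix ι ι ℝ)) hx
    have hd : (R x : Matrix ι ι ℝ).det = (x₀ : Matrix ι ι ℝ).det * (x : Matrix ι ι ℝ).det := by
      change (T * x * Tᵀ).det = _
      rw [hx₀]; simp only [det_mul]; ring
    simp only [hf]
    rw [hd, pairing_congr hT hZ hTu hx₀, Real.mul_rpow hpos.le hdx.le]
    ring
  have hmeas : MeasurableSet (posCone Z) := (isOpen_posCone hZ).measurableSet
  have hne : ENNReal.ofReal |c⁻¹| ≠ 0 := by simpa using hc0
  have hintR : IntegrableOn (f ∘ R) (R ⁻¹' posCone Z) := by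
    rw [preimage_congrMap_posCone hT hTu]
    exact (integrableOn_congr_fun (fun x hx => hfR x hx) hmeas).2 (hint.const_mul _)
  rw [← hemb.integrableOn_map_iff, hmap] at hintR
  have hI := hemb.setIntegral_map (μ := volume) f (posCone Z)
  rw [hmap, preimage_congrMap_posCone hT hTu, setIntegral_congr_fun hmeas (fun x hx => hfR x hx),
    integral_const_mul, Measure.restrict_smul, integral_smul_measure] at hI
  refine ⟨?_, ?_⟩
  · rw [IntegrableOn, Measure.restrict_smul] at hintR
    exact (integrable_smul_measure hne ENNReal.ofReal_ne_top).1 hintR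
  · rw [phi_invProj hT hZ hTu hx₀ hp, delta_invProj hZ hp, gammaInt]
    rw [ENNReal.toReal_ofReal (abs_nonneg _), smul_eq_mul, abs_inv] at hI
    have hc1 : |c| ≠ 0 := abs_ne_zero.2 hc0
    field_simp at hI
    exact hI.trans (by rw [hc, hR]; ring)

end Congruence

/-! ### Block triangular matrices -/

section Lower

variable {r : ℕ} {n : Fin r → ℕ}

theorem block_add (A B : Matrix (Σ k, Fin (n k)) (Σ k, Fin (n k)) ℝ) (l k : Fin r) :
    block (A + B) l k = block A l k + block B l k := rfl

theorem block_transpose (A : Matrix (Σ k, Fin (n k)) (Σ k, Fin (n k)) ℝ) (l k : Fin r) :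
    block Aᵀ l k = (block A k l)ᵀ := rfl

theorem block_mul (A B : Matrix (Σ k, Fin (n k)) (Σ k, Fin (n k)) ℝ) (l k : Fin r) :
    block (A * B) l k = ∑ j, block A l j * block B j k := by
  ext i i'
  simp [block, mul_apply, Fintype.sum_sigma, Matrix.sum_apply]

variable (V : ∀ l k : Fin r, Submodule ℝ (Matrix (Fin (n l)) (Fin (n k)) ℝ))

/-- Block lower triangular matrices whose diagonal blocks are multiples of the identity and whose
block in position `(l, k)` lies in `V l k` for `k < l`. -/
structure IsLower (T : Matrix (Σ k, Fin (n k)) (Σ k, Fin (n k)) ℝ) : Prop where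
  diag : ∀ k, ∃ c : ℝ, block T k k = c • (1 : Matrix (Fin (n k)) (Fin (n k)) ℝ)
  lower : ∀ k l, k < l → block T l k ∈ V l k
  upper : ∀ k l, k < l → block T k l = 0

variable {V}

theorem blockSpace_isSymm : ∀ x ∈ blockSpace V, x.IsSymm := fun _ hx => hx.1

theorem IsLower.add {A B : Matrix (Σ k, Fin (n k)) (Σ k, Fin (n k)) ℝ} (hA : IsLower V A)
    (hB : IsLower V B) : IsLower V (A + B) where
  diag k := by
    obtain ⟨a, ha⟩ := hA.diag k
    obtain ⟨b, hb⟩ := hB.diag k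
    exact ⟨a + b, by rw [block_add, ha, hb, add_smul]⟩
  lower k l h := (V l k).add_mem (hA.lower k l h) (hB.lower k l h)
  upper k l h := by rw [block_add, hA.upper k l h, hB.upper k l h, add_zero]

theorem IsLower.mul (hV : IsAdmissible V) {A B : Matrix (Σ k, Fin (n k)) (Σ k, Fin (n k)) ℝ}
    (hA : IsLower V A) (hB : IsLower V B) : IsLower V (A * B) where
  diag k := by
    obtain ⟨a, ha⟩ := hA.diag k
    obtain ⟨b, hb⟩ := hB.diag k
    refine ⟨a * b, ?_⟩
    rw [block_mul, Finset.sum_eq_single k, ha, hb]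
    · simp [smul_smul, mul_comm]
    · intro j _ hj
      rcases lt_or_gt_of_ne hj with h | h
      · rw [hB.upper j k h, Matrix.mul_zero]
      · rw [hA.upper k j h, Matrix.zero_mul]
    · simp
  lower k l h := by
    rw [block_mul]
    refine (V l k).sum_mem fun j _ => ?_
    rcases lt_trichotomy j k with hj | rfl | hj
    · rw [hB.upper j k hj, Matrix.mul_zero]; exact (V l k).zero_mem
    · obtain ⟨b, hb⟩ := hB.diag j
      rw [hb, Matrix.mul_smul, Matrix.mul_one]
      exact (V l j).smul_mem _ (hA.lower j l h)
    · rcases lt_trichotomy j l with hl | rfl | hl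
      · exact hV.V3 k j l hj hl _ (hA.lower j l hl) _ (hB.lower k j hj)
      · obtain ⟨a, ha⟩ := hA.diag j
        rw [ha, Matrix.smul_mul, Matrix.one_mul]
        exact (V j k).smul_mem _ (hB.lower k j h)
      · rw [hA.upper l j hl, Matrix.zero_mul]; exact (V l k).zero_mem
  upper k l h := by
    rw [block_mul]
    refine Finset.sum_eq_zero fun j _ => ?_
    rcases lt_or_ge k j with hj | hj
    · rw [hA.upper k j hj, Matrix.zero_mul]
    · rw [hB.upper j l (hj.trans_lt h), Matrix.mul_zero]

theorem IsLower.mul_transpose_mem (hV : IsAdmissible V)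
    {A : Matrix (Σ k, Fin (n k)) (Σ k, Fin (n k)) ℝ} (hA : IsLower V A) :
    A * Aᵀ ∈ blockSpace V := by
  refine ⟨by rw [IsSymm, transpose_mul, transpose_transpose], fun k => ?_, fun k l h => ?_⟩
  · have h : ∀ j, ∃ c : ℝ, block A k j * (block A k j)ᵀ = c • 1 := by
      intro j
      rcases lt_trichotomy j k with hj | rfl | hj
      · exact hV.V1 j k hj _ (hA.lower j k hj)
      · obtain ⟨a, ha⟩ := hA.diag j
        exact ⟨a * a, by simp [ha, smul_smul]⟩
      · exact ⟨0, by rw [hA.upper k j hj]; simp⟩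
    choose c hc using h
    refine ⟨∑ j, c j, ?_⟩
    rw [block_mul, Finset.sum_smul]
    exact Finset.sum_congr rfl fun j _ => hc j
  · rw [block_mul]
    refine (V l k).sum_mem fun j _ => ?_
    rw [block_transpose]
    rcases lt_trichotomy j k with hj | rfl | hj
    · exact hV.V2 j k l hj h _ (hA.lower j l (hj.trans h)) _ (hA.lower j k hj)
    · obtain ⟨a, ha⟩ := hA.diag j
      rw [ha, transpose_smul, transpose_one, Matrix.mul_smul, Matrix.mul_one]
      exact (V l j).smul_mem _ (hA.lower j l h)
    · rw [hA.upper k j hj, transpose_zero, Matrix.mul_zero]; exact (V l k).zero_mem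

theorem exists_isLower_add_transpose {x : Matrix (Σ k, Fin (n k)) (Σ k, Fin (n k)) ℝ}
    (hx : x ∈ blockSpace V) : ∃ L, IsLower V L ∧ x = L + Lᵀ := by
  refine ⟨Matrix.of fun i j => if j.1 < i.1 then x i j else if j.1 = i.1 then x i j / 2 else 0,
    ⟨fun k => ?_, fun k l h => ?_, fun k l h => ?_⟩, ?_⟩
  · obtain ⟨c, hc⟩ := hx.2.1 k
    refine ⟨c / 2, ?_⟩
    rw [div_eq_inv_mul, mul_smul, ← hc]
    ext i j
    simp [block, div_eq_inv_mul]
  · convert hx.2.2 k l h using 1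
    ext i j
    simp [block, h]
  · ext i j
    simp [block, h.not_gt, h.ne']
  · ext i j
    have hs : x j i = x i j := hx.1.apply i j
    rcases lt_trichotomy i.1 j.1 with h | h | h
    · simp [h, h.not_gt, h.ne', hs]
    · simp [h, hs]
    · simp [h, h.not_gt, h.ne']

/-- The triangular group acts on the space by congruence.  Writing `x = L + Lᵀ` with `L` triangular,
`T x Tᵀ` is the polarization of `A ↦ A Aᵀ` at `T L` and `T`. -/
theorem IsLower.congr_mem (hV : IsAdmissible V) {T : Matrix (Σ k, Fin (n k)) (Σ k, Fin (n k)) ℝ}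
    (hT : IsLower V T) : ∀ x ∈ blockSpace V, T * x * Tᵀ ∈ blockSpace V := by
  intro x hx
  obtain ⟨L, hL, rfl⟩ := exists_isLower_add_transpose hx
  have hM := hT.mul hV hL
  have h : T * (L + Lᵀ) * Tᵀ =
      (T * L + T) * (T * L + T)ᵀ - (T * L) * (T * L)ᵀ - T * Tᵀ := by
    simp only [transpose_add, transpose_mul, Matrix.mul_add, Matrix.add_mul, Matrix.mul_assoc]
    abel
  rw [h]
  exact (blockSpace V).sub_mem ((blockSpace V).sub_mem ((hM.add hT).mul_transpose_mem hV)
    (hM.mul_transpose_mem hV)) (hT.mul_transpose_mem hV)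

end Lower

/-! ### Splitting off the first block row and column -/

section Glue

variable {r : ℕ} {n : Fin (r + 1) → ℕ}

/-- The index set of `r + 1` blocks, split into the first block and the others. -/
def consEquiv (n : Fin (r + 1) → ℕ) :
    (Σ k, Fin (n k)) ≃ Fin (n 0) ⊕ Σ k : Fin r, Fin (n k.succ) where
  toFun p := Fin.cases (motive := fun k => Fin (n k) → Fin (n 0) ⊕ Σ k : Fin r, Fin (n k.succ))
    Sum.inl (fun k i => Sum.inr ⟨k, i⟩) p.1 p.2
  invFun := Sum.elim (fun i => ⟨0, i⟩) (fun p => ⟨p.1.succ, p.2⟩)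
  left_inv := by
    rintro ⟨k, i⟩
    induction k using Fin.cases <;> rfl
  right_inv := by rintro (i | ⟨k, i⟩) <;> rfl

/-- The block matrix with first block row `A, B` and remaining block rows `C, D`. -/
def glue (A : Matrix (Fin (n 0)) (Fin (n 0)) ℝ)
    (B : Matrix (Fin (n 0)) (Σ k : Fin r, Fin (n k.succ)) ℝ)
    (C : Matrix (Σ k : Fin r, Fin (n k.succ)) (Fin (n 0)) ℝ)
    (D : Matrix (Σ k : Fin r, Fin (n k.succ)) (Σ k : Fin r, Fin (n k.succ)) ℝ) :
    Matrix (Σ k, Fin (n k)) (Σ k, Fin (n k)) ℝ :=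
  (fromBlocks A B C D).submatrix (consEquiv n) (consEquiv n)

/-- The block in block row `l` of a matrix with one block column. -/
def rowBlock (b : Matrix (Σ k : Fin r, Fin (n k.succ)) (Fin (n 0)) ℝ) (l : Fin r) :
    Matrix (Fin (n l.succ)) (Fin (n 0)) ℝ :=
  b.submatrix (fun i => ⟨l, i⟩) id

section
variable (A : Matrix (Fin (n 0)) (Fin (n 0)) ℝ)
    (B : Matrix (Fin (n 0)) (Σ k : Fin r, Fin (n k.succ)) ℝ)
    (C : Matrix (Σ k : Fin r, Fin (n k.succ)) (Fin (n 0)) ℝ)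
    (D : Matrix (Σ k : Fin r, Fin (n k.succ)) (Σ k : Fin r, Fin (n k.succ)) ℝ)

theorem block_glue_zero_zero : block (glue A B C D) 0 0 = A := rfl

theorem exists_eq_glue (x : Matrix (Σ k, Fin (n k)) (Σ k, Fin (n k)) ℝ) :
    ∃ A B C D, x = glue A B C D := by
  set y := x.submatrix (consEquiv n).symm (consEquiv n).symm with hy
  refine ⟨y.toBlocks₁₁, y.toBlocks₁₂, y.toBlocks₂₁, y.toBlocks₂₂, ?_⟩
  rw [glue, fromBlocks_toBlocks, hy, submatrix_submatrix]
  simp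

theorem transpose_glue : (glue A B C D)ᵀ = glue Aᵀ Cᵀ Bᵀ Dᵀ := by
  rw [glue, transpose_submatrix, fromBlocks_transpose]; rfl

theorem glue_mul (A' : Matrix (Fin (n 0)) (Fin (n 0)) ℝ)
    (B' : Matrix (Fin (n 0)) (Σ k : Fin r, Fin (n k.succ)) ℝ)
    (C' : Matrix (Σ k : Fin r, Fin (n k.succ)) (Fin (n 0)) ℝ)
    (D' : Matrix (Σ k : Fin r, Fin (n k.succ)) (Σ k : Fin r, Fin (n k.succ)) ℝ) :
    glue A B C D * glue A' B' C' D' =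
      glue (A * A' + B * C') (A * B' + B * D') (C * A' + D * C') (C * B' + D * D') := by
  rw [glue, glue, submatrix_mul_equiv, fromBlocks_multiply]; rfl

theorem trace_glue : (glue A B C D).trace = A.trace + D.trace := by
  refine (Equiv.sum_comp (consEquiv n) fun i => fromBlocks A B C D i i).trans ?_
  rw [Fintype.sum_sum_type]
  rfl

theorem glue_inj {A' : Matrix (Fin (n 0)) (Fin (n 0)) ℝ}
    {B' : Matrix (Fin (n 0)) (Σ k : Fin r, Fin (n k.succ)) ℝ}
    {C' : Matrix (Σ k : Fin r, Fin (n k.succ)) (Fin (n 0)) ℝ}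
    {D' : Matrix (Σ k : Fin r, Fin (n k.succ)) (Σ k : Fin r, Fin (n k.succ)) ℝ} :
    glue A B C D = glue A' B' C' D' ↔ A = A' ∧ B = B' ∧ C = C' ∧ D = D' := by
  rw [← fromBlocks_inj]
  exact (reindex (consEquiv n).symm (consEquiv n).symm).apply_eq_iff_eq
end

section
variable {c : ℝ} {b : Matrix (Σ k : Fin r, Fin (n k.succ)) (Fin (n 0)) ℝ}
  {x : Matrix (Σ k : Fin r, Fin (n k.succ)) (Σ k : Fin r, Fin (n k.succ)) ℝ}

theorem det_glue_smul_one (hc : c ≠ 0) :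
    (glue (c • 1) bᵀ b x).det = c ^ n 0 * (x - c⁻¹ • (b * bᵀ)).det := by
  have hinv : IsUnit (c • (1 : Matrix (Fin (n 0)) (Fin (n 0)) ℝ)) := by
    rw [isUnit_iff_isUnit_det, det_smul, det_one, mul_one]
    exact (pow_ne_zero _ hc).isUnit
  let _ := hinv.invertible
  have h : ⅟ (c • (1 : Matrix (Fin (n 0)) (Fin (n 0)) ℝ)) = c⁻¹ • 1 := by
    refine invOf_eq_left_inv ?_
    rw [smul_mul_smul_comm, inv_mul_cancel₀ hc, one_smul, Matrix.one_mul]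
  rw [glue, det_submatrix_equiv_self, det_fromBlocks₁₁, h]
  simp

/-- Positive definiteness through the Schur complement of the first diagonal block. -/
theorem posDef_glue_smul_one (hn : 0 < n 0) :
    (glue (c • 1) bᵀ b x).PosDef ↔ 0 < c ∧ (x - c⁻¹ • (b * bᵀ)).PosDef := by
  have key : 0 < c → ((glue (c • 1) bᵀ b x).PosSemidef ↔ (x - c⁻¹ • (b * bᵀ)).PosSemidef) := by
    intro hc
    have hpd : (c • (1 : Matrix (Fin (n 0)) (Fin (n 0)) ℝ)).PosDef := PosDef.one.smul hc
    let _ := hpd.isUnit.invertible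
    have h : (c • (1 : Matrix (Fin (n 0)) (Fin (n 0)) ℝ))⁻¹ = c⁻¹ • 1 := by
      refine inv_eq_left_inv ?_
      rw [smul_mul_smul_comm, inv_mul_cancel₀ hc.ne', one_smul, Matrix.one_mul]
    have := PosDef.fromBlocks₁₁ bᵀ x hpd
    rw [conjTranspose_eq_transpose_of_trivial, transpose_transpose, h] at this
    rw [glue, posSemidef_submatrix_equiv, this]
    simp
  constructor
  · intro h
    have hc : 0 < c := by
      have := h.diag_pos (i := ⟨0, ⟨0, hn⟩⟩)
      change 0 < (c • (1 : Matrix (Fin (n 0)) (Fin (n 0)) ℝ)) ⟨0, hn⟩ ⟨0, hn⟩ at this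
      simpa using this
    refine ⟨hc, ((key hc).1 h.posSemidef).posDef_iff_det_ne_zero.2 fun h0 => h.det_pos.ne' ?_⟩
    rw [det_glue_smul_one hc.ne', h0, mul_zero]
  · rintro ⟨hc, h⟩
    refine ((key hc).2 h.posSemidef).posDef_iff_det_ne_zero.2 ?_
    rw [det_glue_smul_one hc.ne']
    exact mul_ne_zero (pow_ne_zero _ hc.ne') h.det_pos.ne'

end

variable (V : ∀ l k : Fin (r + 1), Submodule ℝ (Matrix (Fin (n l)) (Fin (n k)) ℝ))

/-- The family `V` without its first row and column. -/
def tail (l k : Fin r) : Submodule ℝ (Matrix (Fin (n l.succ)) (Fin (n k.succ)) ℝ) :=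
  V l.succ k.succ

/-- The space of possible first block columns, without the diagonal block. -/
def firstCol : Submodule ℝ (Matrix (Σ k : Fin r, Fin (n k.succ)) (Fin (n 0)) ℝ) where
  carrier := {b | ∀ l, rowBlock b l ∈ V l.succ 0}
  add_mem' hx hy l := (V l.succ 0).add_mem (hx l) (hy l)
  zero_mem' l := (V l.succ 0).zero_mem
  smul_mem' c _ hx l := (V l.succ 0).smul_mem c (hx l)

variable {V}

theorem IsAdmissible.tail (hV : IsAdmissible V) : IsAdmissible (tail V) where
  V1 k l h := hV.V1 k.succ l.succ (Fin.succ_lt_succ_iff.2 h)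
  V2 j k l h h' := hV.V2 j.succ k.succ l.succ (Fin.succ_lt_succ_iff.2 h) (Fin.succ_lt_succ_iff.2 h')
  V3 j k l h h' := hV.V3 j.succ k.succ l.succ (Fin.succ_lt_succ_iff.2 h) (Fin.succ_lt_succ_iff.2 h')

theorem finrank_firstCol : Module.finrank ℝ (firstCol V) = colDim V 0 := by
  let e : firstCol V ≃ₗ[ℝ] (∀ l : Fin r, V l.succ 0) :=
    { toFun := fun b l => ⟨rowBlock b.1 l, b.2 l⟩
      map_add' := fun _ _ => rfl
      map_smul' := fun _ _ => rfl
      invFun := fun B => ⟨Matrix.of fun p j => (B p.1).1 p.2 j, fun l => (B l).2⟩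
      left_inv := fun _ => rfl
      right_inv := fun _ => rfl }
  rw [e.finrank_eq, Module.finrank_pi_fintype, colDim, Fin.Ioi_zero_eq_map, Finset.sum_map]
  rfl

theorem mul_transpose_mem_of_mem_firstCol (hV : IsAdmissible V)
    {b : Matrix (Σ k : Fin r, Fin (n k.succ)) (Fin (n 0)) ℝ} (hb : b ∈ firstCol V) :
    b * bᵀ ∈ blockSpace (tail V) :=
  ⟨by rw [IsSymm, transpose_mul, transpose_transpose],
    fun k => hV.V1 0 k.succ k.succ_pos _ (hb k),
    fun k l h => hV.V2 0 k.succ l.succ k.succ_pos (Fin.succ_lt_succ_iff.2 h) _ (hb l) _ (hb k)⟩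

theorem glue_mem_blockSpace {c : ℝ} {b : Matrix (Σ k : Fin r, Fin (n k.succ)) (Fin (n 0)) ℝ}
    {x : Matrix (Σ k : Fin r, Fin (n k.succ)) (Σ k : Fin r, Fin (n k.succ)) ℝ}
    (hb : b ∈ firstCol V) (hx : x ∈ blockSpace (tail V)) :
    glue (c • 1) bᵀ b x ∈ blockSpace V := by
  refine ⟨?_, fun k => ?_, fun k l h => ?_⟩
  · rw [IsSymm, transpose_glue, transpose_smul, transpose_one, transpose_transpose, hx.1.eq]
  · induction k using Fin.cases with
    | zero => exact ⟨c, rfl⟩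
    | succ k => exact hx.2.1 k
  · induction l using Fin.cases with
    | zero => exact absurd h (Fin.not_lt_zero k)
    | succ l =>
      induction k using Fin.cases with
      | zero => exact hb l
      | succ k => exact hx.2.2 k l (Fin.succ_lt_succ_iff.1 h)

theorem exists_glue_of_mem_blockSpace {x : Matrix (Σ k, Fin (n k)) (Σ k, Fin (n k)) ℝ}
    (hx : x ∈ blockSpace V) :
    ∃ c : ℝ, ∃ b ∈ firstCol V, ∃ x' ∈ blockSpace (tail V), x = glue (c • 1) bᵀ b x' := by
  obtain ⟨A, B, C, D, rfl⟩ := exists_eq_glue x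
  obtain ⟨c, hc⟩ := hx.2.1 0
  have hs := hx.1
  rw [IsSymm, transpose_glue, glue_inj] at hs
  rw [block_glue_zero_zero] at hc
  refine ⟨c, C, fun l => hx.2.2 0 l.succ l.succ_pos, D,
    ⟨hs.2.2.2, fun k => hx.2.1 k.succ,
      fun k l h => hx.2.2 k.succ l.succ (Fin.succ_lt_succ_iff.2 h)⟩, ?_⟩
  rw [hs.2.1, hc]

theorem isLower_glue {c : ℝ} {b : Matrix (Σ k : Fin r, Fin (n k.succ)) (Fin (n 0)) ℝ}
    {T : Matrix (Σ k : Fin r, Fin (n k.succ)) (Σ k : Fin r, Fin (n k.succ)) ℝ}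
    (hb : b ∈ firstCol V) (hT : IsLower (tail V) T) : IsLower V (glue (c • 1) 0 b T) := by
  refine ⟨fun k => ?_, fun k l h => ?_, fun k l h => ?_⟩
  · induction k using Fin.cases with
    | zero => exact ⟨c, rfl⟩
    | succ k => exact hT.diag k
  · induction l using Fin.cases with
    | zero => exact absurd h (Fin.not_lt_zero k)
    | succ l =>
      induction k using Fin.cases with
      | zero => exact hb l
      | succ k => exact hT.lower k l (Fin.succ_lt_succ_iff.1 h)
  · induction l using Fin.cases with
    | zero => exact absurd h (Fin.not_lt_zero k)
    | succ l =>
      induction k using Fin.cases with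
      | zero => rfl
      | succ k => exact hT.upper k l (Fin.succ_lt_succ_iff.1 h)

end Glue

/-- The Cholesky decomposition within the triangular group. -/
theorem exists_isLower_mul_transpose {r : ℕ} {n : Fin r → ℕ} (hn : ∀ k, 0 < n k)
    {V : ∀ l k : Fin r, Submodule ℝ (Matrix (Fin (n l)) (Fin (n k)) ℝ)} (hV : IsAdmissible V)
    {x : Matrix (Σ k, Fin (n k)) (Σ k, Fin (n k)) ℝ} (hx : x ∈ blockSpace V) (hpd : x.PosDef) :
    ∃ T, IsLower V T ∧ x = T * Tᵀ := by
  induction r with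
  | zero =>
    exact ⟨0, ⟨fun k => k.elim0, fun k => k.elim0, fun k => k.elim0⟩, by ext i; exact i.1.elim0⟩
  | succ r ih =>
    obtain ⟨c, b, hb, x', hx', rfl⟩ := exists_glue_of_mem_blockSpace hx
    obtain ⟨hc, hpd'⟩ := (posDef_glue_smul_one (hn 0)).1 hpd
    obtain ⟨T, hT, hxT⟩ := ih (fun k => hn k.succ) hV.tail ((blockSpace (tail V)).sub_mem hx'
      ((blockSpace (tail V)).smul_mem c⁻¹ (mul_transpose_mem_of_mem_firstCol hV hb))) hpd'
    have hs : √c * √c = c := Real.mul_self_sqrt hc.le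
    have hs0 : √c ≠ 0 := (Real.sqrt_pos.2 hc).ne'
    refine ⟨glue (√c • 1) 0 ((√c)⁻¹ • b) T,
      isLower_glue ((firstCol V).smul_mem _ hb) hT, ?_⟩
    rw [transpose_glue, glue_mul, ← hxT, glue_inj]
    refine ⟨?_, ?_, ?_, ?_⟩
    · simp [smul_smul, hs]
    · simp [smul_smul, hs0]
    · simp [smul_smul, hs0]
    · simp [smul_smul, ← mul_inv, hs]

/-! ### The gamma integral of a block space -/

section Gamma

open scoped ENNReal

/-- The integral defining `gammaInt`, with values in `[0, ∞]`. -/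
noncomputable def gammaLInt {ι : Type*} [Fintype ι] [DecidableEq ι]
    (Z : Submodule ℝ (Matrix ι ι ℝ)) (α : ℝ) : ℝ≥0∞ :=
  ∫⁻ x in posCone Z, ENNReal.ofReal (Real.exp (-x.1.trace) * x.1.det ^ α)

/-- The weight integrated over the cone, extended by zero to the whole space. -/
noncomputable def gammaWeight {ι : Type*} [Fintype ι] [DecidableEq ι]
    (Z : Submodule ℝ (Matrix ι ι ℝ)) (α : ℝ) : Z → ℝ≥0∞ :=
  (posCone Z).indicator fun x => ENNReal.ofReal (Real.exp (-x.1.trace) * x.1.det ^ α)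

theorem measurable_gammaWeight {ι : Type*} [Fintype ι] [DecidableEq ι]
    {Z : Submodule ℝ (Matrix ι ι ℝ)} (hZ : ∀ x ∈ Z, x.IsSymm) (α : ℝ) :
    Measurable (gammaWeight Z α) := by
  have h1 : Measurable fun x : Z => x.1.trace :=
    (continuous_subtype_val.matrix_trace).measurable
  have h2 : Measurable fun x : Z => x.1.det := (contDiff_det (Z := Z)).continuous.measurable
  exact ((h1.neg.exp.mul (h2.pow_const α)).ennreal_ofReal).indicator
    (isOpen_posCone hZ).measurableSet

theorem lintegral_gammaWeight {ι : Type*} [Fintype ι] [DecidableEq ι]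
    {Z : Submodule ℝ (Matrix ι ι ℝ)} (hZ : ∀ x ∈ Z, x.IsSymm) (α : ℝ) :
    ∫⁻ x, gammaWeight Z α x = gammaLInt Z α :=
  lintegral_indicator (isOpen_posCone hZ).measurableSet _

theorem integrable_exp_neg_mul_norm_sq {E : Type*} [NormedAddCommGroup E] [InnerProductSpace ℝ E]
    [FiniteDimensional ℝ E] [MeasurableSpace E] [BorelSpace E] {a : ℝ} (ha : 0 < a) :
    Integrable fun v : E => Real.exp (-a * ‖v‖ ^ 2) := by
  have h := (GaussianFourier.integrable_cexp_neg_mul_sq_norm_add (V := E) (b := a)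
    (by simpa using ha) 0 0).norm
  simpa [Complex.norm_exp, ← Complex.ofReal_pow] using h

theorem lintegral_exp_neg_mul_norm_sq {E : Type*} [NormedAddCommGroup E] [InnerProductSpace ℝ E]
    [FiniteDimensional ℝ E] [MeasurableSpace E] [BorelSpace E] {a : ℝ} (ha : 0 < a) :
    ∫⁻ v : E, ENNReal.ofReal (Real.exp (-a * ‖v‖ ^ 2)) =
      ENNReal.ofReal ((Real.pi / a) ^ (Module.finrank ℝ E / 2 : ℝ)) := by
  rw [← GaussianFourier.integral_rexp_neg_mul_sq_norm ha, ofReal_integral_eq_lintegral_ofReal]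
  · exact integrable_exp_neg_mul_norm_sq ha
  · exact ae_of_all _ fun v => (Real.exp_pos _).le

theorem lintegral_rpow_mul_exp_neg_mul {s a : ℝ} (hs : 0 ≤ s) (ha : 0 < a) :
    ∫⁻ t in Set.Ioi (0 : ℝ), ENNReal.ofReal (t ^ s * Real.exp (-(a * t))) =
      ENNReal.ofReal ((1 / a) ^ (s + 1) * Real.Gamma (s + 1)) := by
  have h := Real.integral_rpow_mul_exp_neg_mul_Ioi (a := s + 1) (by linarith) ha
  rw [add_sub_cancel_right] at h
  rw [← h, ofReal_integral_eq_lintegral_ofReal]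
  · refine Integrable.of_integral_ne_zero ?_
    rw [h]
    have := Real.Gamma_pos_of_pos (s := s + 1) (by linarith)
    positivity
  · filter_upwards [ae_restrict_mem measurableSet_Ioi] with t ht
    have : (0 : ℝ) < t := ht
    positivity

variable {r : ℕ} {n : Fin (r + 1) → ℕ}

theorem norm_sq_eq_trace {m k : Type*} [Fintype m] [Fintype k] (A : Matrix m k ℝ) :
    ‖A‖ ^ 2 = (Aᵀ * A).trace := (real_inner_self_eq_norm_sq A).symm

theorem norm_sq_glue (c : ℝ) (b : Matrix (Σ k : Fin r, Fin (n k.succ)) (Fin (n 0)) ℝ)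
    (x : Matrix (Σ k : Fin r, Fin (n k.succ)) (Σ k : Fin r, Fin (n k.succ)) ℝ) :
    ‖glue (c • 1) bᵀ b x‖ ^ 2 = n 0 * c ^ 2 + (2 * ‖b‖ ^ 2 + ‖x‖ ^ 2) := by
  rw [norm_sq_eq_trace, norm_sq_eq_trace, norm_sq_eq_trace, transpose_glue, glue_mul, trace_glue,
    trace_add, trace_add, transpose_transpose, trace_mul_comm b]
  simp
  ring

theorem glue_add (A A' : Matrix (Fin (n 0)) (Fin (n 0)) ℝ)
    (B B' : Matrix (Fin (n 0)) (Σ k : Fin r, Fin (n k.succ)) ℝ)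
    (C C' : Matrix (Σ k : Fin r, Fin (n k.succ)) (Fin (n 0)) ℝ)
    (D D' : Matrix (Σ k : Fin r, Fin (n k.succ)) (Σ k : Fin r, Fin (n k.succ)) ℝ) :
    glue (A + A') (B + B') (C + C') (D + D') = glue A B C D + glue A' B' C' D' := by
  rw [glue, ← fromBlocks_add]; rfl

theorem smul_glue (a : ℝ) (A : Matrix (Fin (n 0)) (Fin (n 0)) ℝ)
    (B : Matrix (Fin (n 0)) (Σ k : Fin r, Fin (n k.succ)) ℝ)
    (C : Matrix (Σ k : Fin r, Fin (n k.succ)) (Fin (n 0)) ℝ)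
    (D : Matrix (Σ k : Fin r, Fin (n k.succ)) (Σ k : Fin r, Fin (n k.succ)) ℝ) :
    a • glue A B C D = glue (a • A) (a • B) (a • C) (a • D) := by
  rw [glue, glue, ← fromBlocks_smul]; rfl

theorem lintegral_withLp_prod {E F : Type*} [NormedAddCommGroup E] [InnerProductSpace ℝ E]
    [FiniteDimensional ℝ E] [MeasurableSpace E] [BorelSpace E] [NormedAddCommGroup F]
    [InnerProductSpace ℝ F] [FiniteDimensional ℝ F] [MeasurableSpace F] [BorelSpace F]
    {f : WithLp 2 (E × F) → ℝ≥0∞} (hf : Measurable f) :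
    ∫⁻ p, f p = ∫⁻ x, ∫⁻ y, f (WithLp.toLp 2 (x, y)) := by
  rw [← (WithLp.volume_preserving_toLp (U := E) (V := F)).lintegral_comp hf, Measure.volume_eq_prod,
    lintegral_prod (fun p => f (WithLp.toLp 2 p))
      (hf.comp (WithLp.measurable_toLp 2 _)).aemeasurable]

variable (V : ∀ l k : Fin (r + 1), Submodule ℝ (Matrix (Fin (n l)) (Fin (n k)) ℝ))

/-- The parametrization of the block space by its diagonal entry, its first block column and the
remaining blocks, scaled so as to be isometric when `n 0` is positive: the identity of size `n 0`
has norm `√(n 0)`, and each off-diagonal block occurs twice. -/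
noncomputable def glueLinear :
    WithLp 2 (ℝ × WithLp 2 (firstCol V × blockSpace (tail V))) →ₗ[ℝ] blockSpace V where
  toFun p := ⟨glue ((p.fst / √(n 0)) • 1) ((√2)⁻¹ • p.snd.fst.1)ᵀ ((√2)⁻¹ • p.snd.fst.1)
      p.snd.snd.1, glue_mem_blockSpace ((firstCol V).smul_mem _ p.snd.fst.2) p.snd.snd.2⟩
  map_add' p q := Subtype.ext (by
    simp only [WithLp.add_fst, WithLp.add_snd, Submodule.coe_add, smul_add, add_div, add_smul,
      transpose_add, glue_add])
  map_smul' a p := Subtype.ext (by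
    simp only [WithLp.smul_fst, WithLp.smul_snd, Submodule.coe_smul, smul_glue, smul_eq_mul,
      mul_div_assoc, mul_smul, transpose_smul, smul_comm a (√2)⁻¹, RingHom.id_apply])

theorem norm_glueLinear (hn : 0 < n 0)
    (p : WithLp 2 (ℝ × WithLp 2 (firstCol V × blockSpace (tail V)))) :
    ‖glueLinear V p‖ = ‖p‖ := by
  have h : (0 : ℝ) < n 0 := by exact_mod_cast hn
  refine (sq_eq_sq₀ (norm_nonneg _) (norm_nonneg _)).1 ?_
  rw [WithLp.prod_norm_sq_eq_of_L2, WithLp.prod_norm_sq_eq_of_L2]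
  refine (norm_sq_glue _ _ _).trans ?_
  rw [norm_smul, mul_pow, div_pow, Real.sq_sqrt h.le, norm_inv, inv_pow,
    Real.norm_of_nonneg (Real.sqrt_nonneg _), Real.sq_sqrt zero_le_two, Real.norm_eq_abs,
    sq_abs, mul_div_cancel₀ _ h.ne', mul_inv_cancel_left₀ two_ne_zero]
  rfl

theorem glueLinear_surjective (hn : 0 < n 0) : Function.Surjective (glueLinear V) := by
  rintro ⟨x, hx⟩
  have h : √(n 0 : ℝ) ≠ 0 := (Real.sqrt_pos.2 (by exact_mod_cast hn)).ne'
  have h2 : √(2 : ℝ) ≠ 0 := (Real.sqrt_pos.2 two_pos).ne'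
  obtain ⟨c, b, hb, x', hx', rfl⟩ := exists_glue_of_mem_blockSpace hx
  refine ⟨WithLp.toLp 2 (c * √(n 0), WithLp.toLp 2
    (⟨√2 • b, (firstCol V).smul_mem _ hb⟩, ⟨x', hx'⟩)), Subtype.ext ?_⟩
  change glue ((c * √(n 0) / √(n 0)) • 1) ((√2)⁻¹ • √2 • b)ᵀ ((√2)⁻¹ • √2 • b) x' = _
  rw [mul_div_cancel_right₀ _ h, smul_smul, inv_mul_cancel₀ h2, one_smul]

/-- The map `glueLinear` as an isometric equivalence. -/
noncomputable def glueIsometry (hn : 0 < n 0) :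
    WithLp 2 (ℝ × WithLp 2 (firstCol V × blockSpace (tail V))) ≃ₗᵢ[ℝ] blockSpace V :=
  LinearIsometryEquiv.ofSurjective ⟨glueLinear V, norm_glueLinear V hn⟩ (glueLinear_surjective V hn)

variable {V}

theorem gammaLInt_eq_lintegral (hn : 0 < n 0) (α : ℝ) :
    gammaLInt (blockSpace V) α = ∫⁻ c : ℝ, ∫⁻ b : firstCol V, ∫⁻ x : blockSpace (tail V),
      gammaWeight (blockSpace V) α
        (glueIsometry V hn (WithLp.toLp 2 (c, WithLp.toLp 2 (b, x)))) := by
  have hm := measurable_gammaWeight (blockSpace_isSymm (V := V)) α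
  have hm1 := hm.comp (glueIsometry V hn).continuous.measurable
  rw [← lintegral_gammaWeight blockSpace_isSymm,
    ← (glueIsometry V hn).measurePreserving.lintegral_comp hm]
  refine (lintegral_withLp_prod hm1).trans ?_
  refine lintegral_congr fun c => ?_
  refine lintegral_withLp_prod
    (f := fun q => gammaWeight (blockSpace V) α (glueIsometry V hn (WithLp.toLp 2 (c, q)))) ?_
  exact hm1.comp ((WithLp.measurable_toLp 2 _).comp measurable_prodMk_left)

/-- The Schur complement turns the weight of the whole space into a product, after a translation
of the remaining blocks. -/
theorem gammaWeight_glueIsometry (hV : IsAdmissible V) (hn : 0 < n 0) {α c : ℝ} (hc : 0 < c)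
    (b : firstCol V) : ∃ s : blockSpace (tail V), ∀ x : blockSpace (tail V),
      gammaWeight (blockSpace V) α (glueIsometry V hn (WithLp.toLp 2 (c, WithLp.toLp 2 (b, x)))) =
        ENNReal.ofReal (Real.exp (-(√(n 0) * c)) * (c / √(n 0)) ^ (n 0 * α)) *
          ENNReal.ofReal (Real.exp (-(2 * (c / √(n 0)))⁻¹ * ‖b‖ ^ 2)) *
          gammaWeight (blockSpace (tail V)) α (x - s) := by
  have hn' : (0 : ℝ) < n 0 := by exact_mod_cast hn
  have hsq : 0 < √(n 0 : ℝ) := Real.sqrt_pos.2 hn'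
  set t := c / √(n 0 : ℝ) with ht
  have ht0 : 0 < t := div_pos hc hsq
  have hnt : n 0 * t = √(n 0) * c := by
    rw [ht, mul_div_assoc', div_eq_iff hsq.ne']
    nth_rewrite 1 [← Real.mul_self_sqrt hn'.le]
    ring
  set b' : Matrix (Σ k : Fin r, Fin (n k.succ)) (Fin (n 0)) ℝ := (√2)⁻¹ • b.1 with hb'
  have hb'm : b' ∈ firstCol V := (firstCol V).smul_mem _ b.2
  have hb'n : (b' * b'ᵀ).trace = ‖b‖ ^ 2 / 2 := by
    rw [trace_mul_comm, ← norm_sq_eq_trace, hb', norm_smul, mul_pow, norm_inv, inv_pow,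
      Real.norm_of_nonneg (Real.sqrt_nonneg _), Real.sq_sqrt zero_le_two, inv_mul_eq_div]
    rfl
  refine ⟨⟨t⁻¹ • (b' * b'ᵀ), (blockSpace (tail V)).smul_mem _
    (mul_transpose_mem_of_mem_firstCol hV hb'm)⟩, fun x => ?_⟩
  set s : blockSpace (tail V) := ⟨t⁻¹ • (b' * b'ᵀ), _⟩
  have happ : (glueIsometry V hn (WithLp.toLp 2 (c, WithLp.toLp 2 (b, x))) : Matrix _ _ ℝ) =
      glue (t • 1) b'ᵀ b' x.1 := rfl
  have hiff : glueIsometry V hn (WithLp.toLp 2 (c, WithLp.toLp 2 (b, x))) ∈ posCone (blockSpace V) ↔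
      x - s ∈ posCone (blockSpace (tail V)) := by
    refine (posDef_glue_smul_one hn).trans ?_
    exact and_iff_right ht0
  by_cases hx : x - s ∈ posCone (blockSpace (tail V))
  · rw [gammaWeight, gammaWeight, Set.indicator_of_mem (hiff.2 hx), Set.indicator_of_mem hx, happ,
      det_glue_smul_one ht0.ne', trace_glue]
    have hpos : 0 < (x.1 - t⁻¹ • (b' * b'ᵀ)).det := PosDef.det_pos hx
    have hx' : x.1.trace = (x - s).1.trace + t⁻¹ * (‖b‖ ^ 2 / 2) := by
      rw [← hb'n, ← smul_eq_mul, ← trace_smul, ← trace_add]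
      congr 1
      exact (sub_add_cancel x.1 s.1).symm
    rw [← ENNReal.ofReal_mul (by positivity), ← ENNReal.ofReal_mul (by positivity),
      Real.mul_rpow (by positivity) hpos.le, hx', trace_smul, trace_one, Fintype.card_fin,
      ← Real.rpow_natCast t (n 0), ← Real.rpow_mul ht0.le, smul_eq_mul, mul_comm t, hnt]
    congr 1
    have : Real.exp (-(√(n 0) * c + ((x - s).1.trace + t⁻¹ * (‖b‖ ^ 2 / 2)))) =
        Real.exp (-(√(n 0) * c)) * Real.exp (-(2 * t)⁻¹ * ‖b‖ ^ 2) *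
          Real.exp (-(x - s).1.trace) := by
      rw [← Real.exp_add, ← Real.exp_add]
      congr 1
      field_simp
      ring
    rw [this]
    change _ * (_ * (x - s).1.det ^ α) = _
    ring
  · rw [gammaWeight, gammaWeight, Set.indicator_of_notMem (fun h => hx (hiff.1 h)),
      Set.indicator_of_notMem hx, mul_zero]

theorem gammaWeight_glueIsometry_of_nonpos (hn : 0 < n 0) {α c : ℝ} (hc : c ≤ 0)
    (b : firstCol V) (x : blockSpace (tail V)) :
    gammaWeight (blockSpace V) α
      (glueIsometry V hn (WithLp.toLp 2 (c, WithLp.toLp 2 (b, x)))) = 0 := by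
  refine Set.indicator_of_notMem (fun h => ?_) _
  have h1 := ((posDef_glue_smul_one hn).1 h).1
  exact absurd h1 (not_lt.2 (div_nonpos_of_nonpos_of_nonneg hc (Real.sqrt_nonneg _)))

/-- The recursion for the gamma integral: a translation removes the dependence of the Schur
complement on the first block column, which then contributes a Gaussian integral, and the diagonal
entry an Euler integral. -/
theorem gammaLInt_succ (hV : IsAdmissible V) (hn : 0 < n 0) {α : ℝ} (hα : 0 ≤ α) :
    gammaLInt (blockSpace V) α =
      ENNReal.ofReal ((2 * Real.pi) ^ ((colDim V 0 : ℝ) / 2) *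
        ((n 0 : ℝ) ^ (-(n 0 : ℝ) * α - ((colDim V 0 : ℝ) + 1) / 2) *
          Real.Gamma ((n 0 : ℝ) * α + (colDim V 0 : ℝ) / 2 + 1))) *
        gammaLInt (blockSpace (tail V)) α := by
  have hn' : (0 : ℝ) < n 0 := by exact_mod_cast hn
  have hsq : 0 < √(n 0 : ℝ) := Real.sqrt_pos.2 hn'
  set q : ℝ := (colDim V 0 : ℝ) with hq
  have hq0 : 0 ≤ q := Nat.cast_nonneg _
  set m : ℝ := √(n 0 : ℝ) with hm
  set s : ℝ := n 0 * α + q / 2 with hs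
  have hs0 : 0 ≤ s := by positivity
  have hinner : ∀ c : ℝ, (∫⁻ b : firstCol V, ∫⁻ x : blockSpace (tail V),
      gammaWeight (blockSpace V) α (glueIsometry V hn (WithLp.toLp 2 (c, WithLp.toLp 2 (b, x))))) =
      (Set.Ioi (0 : ℝ)).indicator (fun c => ENNReal.ofReal ((2 * Real.pi) ^ (q / 2) * m ^ (-s)) *
        gammaLInt (blockSpace (tail V)) α * ENNReal.ofReal (c ^ s * Real.exp (-(m * c)))) c := by
    intro c
    by_cases hc : 0 < c
    · rw [Set.indicator_of_mem (show c ∈ Set.Ioi (0 : ℝ) from hc)]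
      have ht0 : 0 < c / m := div_pos hc hsq
      have h1 : ∀ b : firstCol V, (∫⁻ x : blockSpace (tail V), gammaWeight (blockSpace V) α
          (glueIsometry V hn (WithLp.toLp 2 (c, WithLp.toLp 2 (b, x))))) =
          ENNReal.ofReal (Real.exp (-(m * c)) * (c / m) ^ (n 0 * α)) *
            gammaLInt (blockSpace (tail V)) α *
            ENNReal.ofReal (Real.exp (-(2 * (c / m))⁻¹ * ‖b‖ ^ 2)) := by
        intro b
        obtain ⟨w, hw⟩ := gammaWeight_glueIsometry (α := α) hV hn hc b
        simp only [hw]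
        rw [lintegral_const_mul' _ _
            (ENNReal.mul_ne_top ENNReal.ofReal_ne_top ENNReal.ofReal_ne_top),
          lintegral_sub_right_eq_self (gammaWeight (blockSpace (tail V)) α) w,
          lintegral_gammaWeight blockSpace_isSymm]
        ring
      simp only [h1]
      rw [lintegral_const_mul _ (by fun_prop), lintegral_exp_neg_mul_norm_sq (by positivity),
        finrank_firstCol, ← hq, div_inv_eq_mul, mul_right_comm,
        ← ENNReal.ofReal_mul (by positivity),
        mul_right_comm (ENNReal.ofReal _) (gammaLInt _ _) (ENNReal.ofReal _),
        ← ENNReal.ofReal_mul (by positivity)]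
      congr 2
      rw [← mul_assoc, mul_comm Real.pi 2, Real.mul_rpow (by positivity) ht0.le,
        Real.div_rpow hc.le hsq.le, Real.div_rpow hc.le hsq.le, hs, Real.rpow_add hc,
        Real.rpow_neg hsq.le, Real.rpow_add hsq]
      have h3 := (Real.rpow_pos_of_pos hsq (n 0 * α)).ne'
      have h4 := (Real.rpow_pos_of_pos hsq (q / 2)).ne'
      field_simp
    · rw [Set.indicator_of_notMem (show c ∉ Set.Ioi (0 : ℝ) from hc)]
      simp only [gammaWeight_glueIsometry_of_nonpos hn (not_lt.1 hc), lintegral_zero]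
  rw [gammaLInt_eq_lintegral hn, lintegral_congr hinner, lintegral_indicator measurableSet_Ioi,
    lintegral_const_mul _ (by fun_prop), lintegral_rpow_mul_exp_neg_mul hs0 hsq,
    mul_right_comm, ← ENNReal.ofReal_mul (by positivity)]
  congr 2
  rw [mul_assoc, ← mul_assoc (m ^ (-s))]
  congr 2
  rw [one_div, Real.inv_rpow hsq.le, ← Real.rpow_neg hsq.le, ← Real.rpow_add hsq, hm,
    Real.sqrt_eq_rpow, ← Real.rpow_mul hn'.le]
  congr 1
  rw [hs]; ring

end Gamma

/-! ### Evaluation of the gamma integral and the factorization formula -/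

theorem colDim_succ {r : ℕ} {n : Fin (r + 1) → ℕ}
    (V : ∀ l k : Fin (r + 1), Submodule ℝ (Matrix (Fin (n l)) (Fin (n k)) ℝ)) (k : Fin r) :
    colDim V k.succ = colDim (tail V) k := by
  rw [colDim, colDim, Fin.Ioi_succ, Finset.sum_map]
  rfl

theorem finrank_blockSpace {r : ℕ} {n : Fin r → ℕ} (hn : ∀ k, 0 < n k)
    (V : ∀ l k : Fin r, Submodule ℝ (Matrix (Fin (n l)) (Fin (n k)) ℝ)) :
    Module.finrank ℝ (blockSpace V) = r + ∑ k, colDim V k := by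
  induction r with
  | zero =>
    have : Subsingleton (blockSpace V) := ⟨fun x y => Subtype.ext (by ext i; exact i.1.elim0)⟩
    simp [Module.finrank_zero_of_subsingleton]
  | succ r ih =>
    rw [← (glueIsometry V (hn 0)).toLinearEquiv.finrank_eq,
      (WithLp.linearEquiv 2 ℝ _).finrank_eq, Module.finrank_prod,
      (WithLp.linearEquiv 2 ℝ _).finrank_eq, Module.finrank_prod, finrank_firstCol,
      ih (fun k => hn k.succ) (tail V), Module.finrank_self, Fin.sum_univ_succ]
    simp only [colDim_succ]
    ring

theorem gammaLInt_blockSpace {r : ℕ} {n : Fin r → ℕ} (hn : ∀ k, 0 < n k)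
    {V : ∀ l k : Fin r, Submodule ℝ (Matrix (Fin (n l)) (Fin (n k)) ℝ)} (hV : IsAdmissible V)
    {α : ℝ} (hα : 0 ≤ α) :
    gammaLInt (blockSpace V) α = ENNReal.ofReal (∏ k, ((2 * Real.pi) ^ ((colDim V k : ℝ) / 2) *
        ((n k : ℝ) ^ (-(n k : ℝ) * α - ((colDim V k : ℝ) + 1) / 2) *
          Real.Gamma ((n k : ℝ) * α + (colDim V k : ℝ) / 2 + 1)))) := by
  induction r with
  | zero =>
    have : Unique (blockSpace V) := ⟨⟨0⟩, fun x => Subtype.ext (by ext i; exact i.1.elim0)⟩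
    have hpos : posCone (blockSpace V) = Set.univ := Set.eq_univ_of_forall fun x =>
      ⟨by ext i; exact i.1.elim0, fun v hv => absurd (by ext i; exact i.1.elim0) hv⟩
    -- The space is a point, on which Lebesgue measure is the unit mass.
    have hvol : (volume : Measure (blockSpace V)) Set.univ = 1 := by
      rw [← (stdOrthonormalBasis ℝ (blockSpace V)).volume_parallelepiped]
      congr 1
      refine (Set.eq_univ_of_forall fun x => ?_).symm
      exact (mem_parallelepiped_iff _ _).2
        ⟨0, Set.left_mem_Icc.2 zero_le_one, Subsingleton.elim _ _⟩
    have : (fun x : blockSpace V => ENNReal.ofReal (Real.exp (-x.1.trace) * x.1.det ^ α)) =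
        fun _ => 1 := by
      funext x
      simp [trace, det_isEmpty]
    rw [gammaLInt, hpos, Measure.restrict_univ, this, lintegral_const, hvol]
    simp
  | succ r ih =>
    rw [gammaLInt_succ hV (hn 0) hα, ih (fun k => hn k.succ) hV.tail, Fin.prod_univ_succ,
      ← ENNReal.ofReal_mul']
    · simp only [colDim_succ]
    · refine Finset.prod_nonneg fun k _ => ?_
      have := Real.Gamma_pos_of_pos
        (s := (n k.succ : ℝ) * α + (colDim (tail V) k : ℝ) / 2 + 1) (by positivity)
      positivity

/-- The factors `(2π) ^ (q_k / 2)` combine to the power of `2π` in terms of the dimension. -/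
theorem gammaProd_eq {r : ℕ} {n : Fin r → ℕ} (hn : ∀ k, 0 < n k)
    (V : ∀ l k : Fin r, Submodule ℝ (Matrix (Fin (n l)) (Fin (n k)) ℝ)) (f : Fin r → ℝ) :
    ∏ k, ((2 * Real.pi) ^ ((colDim V k : ℝ) / 2) * f k) =
      (2 * Real.pi) ^ (((Module.finrank ℝ (blockSpace V) : ℝ) - r) / 2) * ∏ k, f k := by
  rw [Finset.prod_mul_distrib, ← Real.rpow_sum_of_pos (by positivity), ← Finset.sum_div,
    finrank_blockSpace hn]
  push_cast
  rw [add_sub_cancel_left]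

theorem integrableOn_and_gammaInt_eq {ι : Type*} [Fintype ι] [DecidableEq ι]
    {Z : Submodule ℝ (Matrix ι ι ℝ)} (hZ : ∀ x ∈ Z, x.IsSymm) {α c : ℝ} (hc : 0 ≤ c)
    (h : gammaLInt Z α = ENNReal.ofReal c) :
    IntegrableOn (fun x : Z => Real.exp (-x.1.trace) * x.1.det ^ α) (posCone Z) ∧
      gammaInt Z α = c := by
  have hmeas : MeasurableSet (posCone Z) := (isOpen_posCone hZ).measurableSet
  have h1 : Measurable fun x : Z => x.1.trace :=
    (continuous_subtype_val.matrix_trace).measurable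
  have h2 : Measurable fun x : Z => x.1.det := (contDiff_det (Z := Z)).continuous.measurable
  have h3 : Measurable fun x : Z => Real.exp (-x.1.trace) * x.1.det ^ α :=
    h1.neg.exp.mul (h2.pow_const α)
  have h0 : 0 ≤ᵐ[volume.restrict (posCone Z)]
      fun x : Z => Real.exp (-x.1.trace) * x.1.det ^ α := by
    filter_upwards [ae_restrict_mem hmeas] with x hx
    have := PosDef.det_pos (A := (x : Matrix ι ι ℝ)) hx
    exact mul_nonneg (Real.exp_pos _).le (Real.rpow_nonneg this.le α)
  refine ⟨⟨h3.aestronglyMeasurable, ?_⟩, ?_⟩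
  · rw [hasFiniteIntegral_iff_ofReal h0]
    exact h.trans_lt ENNReal.ofReal_lt_top
  · rw [gammaInt, integral_eq_lintegral_of_nonneg_ae h0 h3.aestronglyMeasurable]
    exact (congrArg ENNReal.toReal h).trans (ENNReal.toReal_ofReal hc)

theorem posCone_blockSpace_nonempty {r : ℕ} {n : Fin r → ℕ}
    (V : ∀ l k : Fin r, Submodule ℝ (Matrix (Fin (n l)) (Fin (n k)) ℝ)) :
    (posCone (blockSpace V)).Nonempty := by
  refine ⟨⟨1, ⟨isSymm_one, fun k => ⟨1, ?_⟩, fun k l h => ?_⟩⟩, PosDef.one⟩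
  · rw [one_smul]
    ext i j
    simp [block, one_apply]
  · convert (V l k).zero_mem
    ext i j
    simp [block, one_apply, h.ne']

end MatrixCone

theorem theorem2 (r : ℕ) (n : Fin r → ℕ) (hn : ∀ k, 0 < n k)
    (V : ∀ l k : Fin r, Submodule ℝ (Matrix (Fin (n l)) (Fin (n k)) ℝ))
    (hV : MatrixCone.IsAdmissible V) :
    -- (i) the integral converges and has the stated value
    (∀ α : ℝ, 0 ≤ α →
      IntegrableOn
        (fun x : MatrixCone.blockSpace V => Real.exp (-x.1.trace) * x.1.det ^ α)
        (MatrixCone.posCone (MatrixCone.blockSpace V)) ∧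
      MatrixCone.gammaInt (MatrixCone.blockSpace V) α =
        (2 * Real.pi) ^ (((Module.finrank ℝ (MatrixCone.blockSpace V) : ℝ) - r) / 2) *
          ∏ k : Fin r,
            ((n k : ℝ) ^ (-(n k : ℝ) * α - ((MatrixCone.colDim V k : ℝ) + 1) / 2) *
              Real.Gamma ((n k : ℝ) * α + (MatrixCone.colDim V k : ℝ) / 2 + 1))) ∧
    -- (ii) the functions are well defined on the dual cone and the factorization formula holds
    (∀ y ∈ MatrixCone.dualCone (MatrixCone.blockSpace V),
      (∃! x, MatrixCone.IsMaximizer (MatrixCone.blockSpace V) y x) ∧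
      (∃! S, MatrixCone.IsHessianOperator (MatrixCone.blockSpace V) y S) ∧
      ∀ α : ℝ, 0 ≤ α →
        IntegrableOn
          (fun x : MatrixCone.blockSpace V =>
            Real.exp (-MatrixCone.pairing x.1 y.1) * x.1.det ^ α)
          (MatrixCone.posCone (MatrixCone.blockSpace V)) ∧
        ∫ x in MatrixCone.posCone (MatrixCone.blockSpace V),
            Real.exp (-MatrixCone.pairing x.1 y.1) * x.1.det ^ α =
          MatrixCone.gammaInt (MatrixCone.blockSpace V) α *
            MatrixCone.phi (MatrixCone.blockSpace V) y *
            MatrixCone.delta (MatrixCone.blockSpace V) y ^ (-α)) := by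
  have hgamma : ∀ α : ℝ, 0 ≤ α → _ := fun α hα =>
    MatrixCone.integrableOn_and_gammaInt_eq MatrixCone.blockSpace_isSymm (by
        refine Finset.prod_nonneg fun k _ => ?_
        have := Real.Gamma_pos_of_pos
          (s := (n k : ℝ) * α + (MatrixCone.colDim V k : ℝ) / 2 + 1) (by positivity)
        positivity)
      (MatrixCone.gammaLInt_blockSpace hn hV hα)
  refine ⟨fun α hα => ⟨(hgamma α hα).1, (hgamma α hα).2.trans (MatrixCone.gammaProd_eq hn V _)⟩,
    fun y hy => ?_⟩
  have hZ := MatrixCone.blockSpace_isSymm (V := V)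
  obtain ⟨x₀, hx₀⟩ := MatrixCone.exists_isMaximizer hZ (MatrixCone.posCone_blockSpace_nonempty V) hy
  have hp := hx₀.1
  -- The first-order condition at the maximizer says that `y` is the projection of its inverse.
  have hxy : MatrixCone.invProj (MatrixCone.blockSpace V) x₀ = y :=
    MatrixCone.eq_of_forall_pairing_eq hZ fun v => by
      rw [MatrixCone.pairing_invProj hZ, MatrixCone.pairing_eq_of_isMaximizer hZ hx₀]
  obtain ⟨T, hT, hxT⟩ := MatrixCone.exists_isLower_mul_transpose hn hV x₀.2 hp
  have hTu : IsUnit T := by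
    rw [isUnit_iff_isUnit_det]
    have := (PosDef.det_pos (A := x₀.1) hp).ne'
    rw [hxT, det_mul] at this
    exact (left_ne_zero_of_mul this).isUnit
  refine ⟨⟨x₀, hx₀, (MatrixCone.isMaximizer_unique_of_pairing_eq hp
    (MatrixCone.pairing_eq_of_isMaximizer hZ hx₀)).2⟩, ?_, fun α hα => ?_⟩
  · rw [← hxy]
    exact ⟨_, (MatrixCone.isHessianOperator_iff hZ hp _).2 rfl,
      fun S => (MatrixCone.isHessianOperator_iff hZ hp S).1⟩
  · rw [← hxy]
    exact MatrixCone.integral_exp_neg_pairing (hT.congr_mem hV) hZ hTu hxT hp (hgamma α hα).1
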